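/- Let $\{S_i\}_{i=1}^N$ ($N\ge 1$) be an iterated function system of contractive similitudes on $\mathbb R^d$, i.e. $|S_i(p)-S_i(q)|=r_i|p-q|$ with $r_i\in(0,1)$, and let $K$ be its self-similar set, the unique non-empty compact set with $K=\bigcup_{i=1}^N S_i(K)$. For a finite word $x=i_1\cdots i_k$ over $\{1,\dots,N\}$ put $S_x=S_{i_1}\circ\cdots\circ S_{i_k}$ and $r_x=r_{i_1}\cdots r_{i_k}$; let $r=\min_i r_i$, and let $\vartheta$ be the empty word. Put $X_0=\{\vartheta\}$, $$X_n=\{x=i_1\cdots i_k:\ r_x\le r^n<r_{i_1}\cdots r_{i_{k-1}}\}\quad (n\ge1),\qquad X=\bigcup_{n\ge 0}X_n ,$$ and $|x|=n$ for $x\in X_n$. Fix $\kappa>0$. The augmented tree $(X,\mathcal E)$, $\mathcal E=\mathcal E_v\cup\mathcal E_h$, has the vertical edges $\mathcal E_v$, which join $x\in X_{n}$ and $y\in X_{n+1}$ when $x$ is an initial segment of $y$, and the horizontal edges $\mathcal E_h$, which join $x\neq y$ when $|x|=|y|$ and $\operatorname{dist}(S_x(K),S_y(K))\le\kappa r^{|x|}$.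 The quotient $(X^\sim,\mathcal E)$ is obtained by identifying $x,y\in X$ whenever $|x|=|y|$ and $S_x=S_y$, two distinct classes being joined by a vertical (horizontal) edge when some representatives of them are. A horizontal component is a connected component of the graph formed by the horizontal edges; its size is its number of vertices. A graph is of bounded degree if its vertex degrees are uniformly bounded. For a connected graph with root $\vartheta$ and graph distance $d$, let $|x\wedge y|=\frac12\big(d(\vartheta,x)+d(\vartheta,y)-d(x,y)\big)$. The graph is hyperbolic if for some $\delta>0$ one has $|x\wedge y|\ge\min\{|x\wedge z|,|z\wedge y|\}-\delta$ for all $x,y,z$. For $a>0$ let $\rho_a(x,x)=0$ and $\rho_a(x,y)=e^{-a|x\wedge y|}$ for $x\ne y$. The hyperbolic boundary of a hyperbolic graph is its $\rho_a$-completion (the completion for the uniform structure generated by the sets $\{\rho_a<\varepsilon\}$, $\varepsilon>0$) minus the set of vertices. **Theorem 1.4.** Let $a>0$. 1. The graph $(X,\mathcal E)$ is connected and hyperbolic. If it is of bounded degree, then its hyperbolic boundary $\partial X$ is totally disconnected if and only if the sizes of the horizontal components of $X$ are uniformly bounded; and likewise $K$ is totally disconnected if and only if the sizes of the horizontal components of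 $X$ are uniformly bounded. 2. The same holds for the quotient: $(X^\sim,\mathcal E)$ is connected and hyperbolic, and if it is of bounded degree, then its hyperbolic boundary $\partial X^\sim$ is totally disconnected if and only if the sizes of the horizontal components of $X^\sim$ are uniformly bounded; and likewise $K$ is totally disconnected if and only if the sizes of the horizontal components of $X^\sim$ are uniformly bounded. -/

import Mathlib

/-! ### Hyperbolic graphs and their boundaries -/

noncomputable section

namespace HypGraph

variable {V : Type*}

/-- The Gromov product `|x ∧ y| = (|x| + |y| - d(x, y)) / 2` of a graph with root `o`, where
`d` is the graph distance and `|x| = d(o, x)`. -/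
def gromovProduct (G : SimpleGraph V) (o x y : V) : ℝ :=
  ((G.dist o x : ℝ) + (G.dist o y : ℝ) - (G.dist x y : ℝ)) / 2

/-- A connected graph is hyperbolic with respect to the root `o`. -/
def IsHyperbolic (G : SimpleGraph V) (o : V) : Prop :=
  G.Connected ∧ ∃ δ : ℝ, 0 < δ ∧ ∀ x y z : V,
    min (gromovProduct G o x z) (gromovProduct G o z y) - δ ≤ gromovProduct G o x y

open Classical in
/-- The visual (quasi-)metric `ρ_a`. -/
def rho (G : SimpleGraph V) (o : V) (a : ℝ) (x y : V) : ℝ :=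
  if x = y then 0 else Real.exp (-a * gromovProduct G o x y)

theorem gromovProduct_comm (G : SimpleGraph V) (o x y : V) :
    gromovProduct G o x y = gromovProduct G o y x := by
  unfold gromovProduct
  rw [SimpleGraph.dist_comm (u := x) (v := y)]
  ring

theorem rho_comm (G : SimpleGraph V) (o : V) (a : ℝ) (x y : V) :
    rho G o a x y = rho G o a y x := by
  unfold rho
  rw [gromovProduct_comm G o x y]
  by_cases h : x = y
  · rw [if_pos h, if_pos h.symm]
  · rw [if_neg h, if_neg (Ne.symm h)]

theorem rho_nonneg (G : SimpleGraph V) (o : V) (a : ℝ) (x y : V) : 0 ≤ rho G o a x y := by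
  unfold rho
  split_ifs
  · exact le_rfl
  · exact (Real.exp_pos _).le

/-- In a hyperbolic graph `ρ_a` satisfies the ultrametric inequality up to a constant factor. -/
theorem exists_rho_le_mul_max {G : SimpleGraph V} {o : V} {a : ℝ} (ha : 0 < a)
    (h : IsHyperbolic G o) : ∃ C : ℝ, 0 < C ∧ ∀ x y z : V,
      rho G o a x y ≤ C * max (rho G o a x z) (rho G o a z y) := by
  obtain ⟨-, δ, hδ, h⟩ := h
  refine ⟨Real.exp (a * δ), Real.exp_pos _, fun x y z => ?_⟩
  have h1 : (1 : ℝ) ≤ Real.exp (a * δ) := Real.one_le_exp (by positivity)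
  have hxz := rho_nonneg G o a x z
  have hzy := rho_nonneg G o a z y
  by_cases e1 : x = z
  · subst e1
    have h2 : rho G o a x y ≤ max (rho G o a x x) (rho G o a x y) := le_max_right _ _
    nlinarith [rho_nonneg G o a x y]
  by_cases e2 : z = y
  · subst e2
    have h2 : rho G o a x z ≤ max (rho G o a x z) (rho G o a z z) := le_max_left _ _
    nlinarith [rho_nonneg G o a x z]
  by_cases e3 : x = y
  · have h2 : rho G o a x y = 0 := by simp [rho, e3]
    rw [h2]
    have : 0 ≤ max (rho G o a x z) (rho G o a z y) := le_max_of_le_left hxz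
    positivity
  · simp only [rho, e1, e2, e3, if_false]
    rw [mul_max_of_nonneg _ _ (Real.exp_pos _).le, ← Real.exp_add, ← Real.exp_add, le_max_iff,
      Real.exp_le_exp, Real.exp_le_exp]
    have h3 := h x y z
    rcases min_choice (gromovProduct G o x z) (gromovProduct G o z y) with h4 | h4
    · left
      rw [h4] at h3
      nlinarith
    · right
      rw [h4] at h3
      nlinarith

/-- The vertex set of a hyperbolic graph, carrying the uniform structure of `ρ_a`. -/
def VisualSpace (G : SimpleGraph V) (o : V) (a : ℝ) (_ha : 0 < a) (_h : IsHyperbolic G o) :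
    Type _ := V

/-- The uniform structure whose entourages are generated by the sets `{(x, y) | ρ_a(x, y) < ε}`. -/
instance instUniformSpaceVisualSpace (G : SimpleGraph V) (o : V) (a : ℝ) (ha : 0 < a)
    (h : IsHyperbolic G o) : UniformSpace (VisualSpace G o a ha h) :=
  UniformSpace.ofCore
    (UniformSpace.Core.mkOfBasis (α := V)
      { sets := {s | ∃ ε : ℝ, 0 < ε ∧ s = {p : V × V | rho G o a p.1 p.2 < ε}}
        nonempty := ⟨_, 1, one_pos, rfl⟩
        inter_sets := by
          rintro _ _ ⟨ε, hε, rfl⟩ ⟨η, hη, rfl⟩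
          refine ⟨_, ⟨min ε η, lt_min hε hη, rfl⟩, fun p hp => ?_⟩
          exact lt_min_iff.1 (show rho G o a p.1 p.2 < min ε η from hp) }
      (by
        rintro _ ⟨ε, hε, rfl⟩ x
        simpa [rho] using hε)
      (by
        rintro _ ⟨ε, hε, rfl⟩
        refine ⟨_, ⟨ε, hε, rfl⟩, fun p hp => ?_⟩
        simpa [rho_comm G o a p.2 p.1] using hp)
      (by
        rintro _ ⟨ε, hε, rfl⟩
        obtain ⟨C, hC, hle⟩ := exists_rho_le_mul_max ha h
        refine ⟨_, ⟨ε / C, div_pos hε hC, rfl⟩, ?_⟩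
        rintro ⟨x, y⟩ ⟨z, hxz, hzy⟩
        have h1 : max (rho G o a x z) (rho G o a z y) < ε / C := max_lt hxz hzy
        have h2 : C * max (rho G o a x z) (rho G o a z y) < ε := by
          rwa [lt_div_iff₀' hC] at h1
        exact lt_of_le_of_lt (hle x y z) h2))

/-- The hyperbolic boundary: the `ρ_a`-completion of the vertex set minus the vertex set. -/
def boundary (G : SimpleGraph V) (o : V) (a : ℝ) (ha : 0 < a) (h : IsHyperbolic G o) :
    Set (UniformSpace.Completion (VisualSpace G o a ha h)) :=
  (Set.range ((↑) : VisualSpace G o a ha h → UniformSpace.Completion (VisualSpace G o a ha h)))ᶜ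

/-- A graph is of bounded degree. -/
def BoundedDegree (G : SimpleGraph V) : Prop :=
  ∃ D : ℕ, ∀ x : V, (G.neighborSet x).encard ≤ D

/-- The sizes of the connected components of a graph are uniformly bounded. -/
def BoundedComponents (G : SimpleGraph V) : Prop :=
  ∃ M : ℕ, ∀ T : G.ConnectedComponent, T.supp.encard ≤ M

end HypGraph

/-! ### Iterated function systems of contractive similitudes -/

/-- An IFS `{S_i}_{i=1}^N` (`N ≥ 1`) of contractive similitudes on `ℝ^d` with
contraction ratios `r_i ∈ (0, 1)`. -/
structure SimilitudeIFS (d N : ℕ) where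
  /-- the maps `S_i` -/
  map : Fin N → EuclideanSpace ℝ (Fin d) → EuclideanSpace ℝ (Fin d)
  /-- the ratios `r_i` -/
  ratio : Fin N → ℝ
  N_pos : 0 < N
  ratio_pos : ∀ i, 0 < ratio i
  ratio_lt_one : ∀ i, ratio i < 1
  dist_map : ∀ i p q, dist (map i p) (map i q) = ratio i * dist p q

namespace SimilitudeIFS

open TopologicalSpace HypGraph

variable {d N : ℕ} (F : SimilitudeIFS d N)

theorem continuous_map (i : Fin N) : Continuous (F.map i) :=
  (LipschitzWith.of_dist_le_mul (K := ⟨F.ratio i, (F.ratio_pos i).le⟩)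
    fun p q => (F.dist_map i p q).le).continuous

/-- The set map `A ↦ ⋃ i, S_i(A)` on non-empty compact sets. -/
def hutchinson (A : NonemptyCompacts (EuclideanSpace ℝ (Fin d))) :
    NonemptyCompacts (EuclideanSpace ℝ (Fin d)) where
  carrier := ⋃ i, F.map i '' (A : Set (EuclideanSpace ℝ (Fin d)))
  isCompact' := isCompact_iUnion fun i => A.isCompact.image (F.continuous_map i)
  nonempty' := by
    obtain ⟨p, hp⟩ := A.nonempty
    exact ⟨F.map ⟨0, F.N_pos⟩ p, Set.mem_iUnion.2 ⟨⟨0, F.N_pos⟩, p, hp, rfl⟩⟩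

theorem exists_contracting : ∃ c : NNReal, ContractingWith c F.hutchinson := by
  have : Nonempty (Fin N) := ⟨⟨0, F.N_pos⟩⟩
  obtain ⟨j, hj⟩ := Finite.exists_max F.ratio
  refine ⟨⟨F.ratio j, (F.ratio_pos j).le⟩, by exact_mod_cast F.ratio_lt_one j, ?_⟩
  refine LipschitzWith.of_dist_le_mul fun A B => ?_
  rw [Metric.NonemptyCompacts.dist_eq, Metric.NonemptyCompacts.dist_eq]
  have key : ∀ A B : NonemptyCompacts (EuclideanSpace ℝ (Fin d)),
      ∀ x ∈ (F.hutchinson A : Set (EuclideanSpace ℝ (Fin d))),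
      ∃ y ∈ (F.hutchinson B : Set (EuclideanSpace ℝ (Fin d))), dist x y ≤
        F.ratio j * Metric.hausdorffDist (A : Set (EuclideanSpace ℝ (Fin d))) B := by
    intro A B x hx
    obtain ⟨i, p, hp, rfl⟩ := Set.mem_iUnion.1 hx
    obtain ⟨q, hq, hpq⟩ := B.isCompact.exists_infDist_eq_dist B.nonempty p
    refine ⟨F.map i q, Set.mem_iUnion.2 ⟨i, q, hq, rfl⟩, ?_⟩
    rw [F.dist_map, ← hpq]
    have hfin := Metric.hausdorffEDist_ne_top_of_nonempty_of_bounded A.nonempty B.nonempty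
      A.isCompact.isBounded B.isCompact.isBounded
    exact mul_le_mul (hj i) (Metric.infDist_le_hausdorffDist_of_mem hp hfin)
      Metric.infDist_nonneg (F.ratio_pos j).le
  refine Metric.hausdorffDist_le_of_mem_dist
    (mul_nonneg (F.ratio_pos j).le Metric.hausdorffDist_nonneg) (key A B) ?_
  intro x hx
  obtain ⟨y, hy, hxy⟩ := key B A x hx
  exact ⟨y, hy, by rwa [Metric.hausdorffDist_comm] at hxy⟩

/-- There is exactly one non-empty compact `K ⊆ ℝ^d` with `K = ⋃ i, S_i(K)`. -/
theorem existsUnique_attractor : ∃! K : Set (EuclideanSpace ℝ (Fin d)),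
    K.Nonempty ∧ IsCompact K ∧ K = ⋃ i, F.map i '' K := by
  obtain ⟨c, hc⟩ := F.exists_contracting
  have : Nonempty (NonemptyCompacts (EuclideanSpace ℝ (Fin d))) := ⟨{0}⟩
  refine ⟨(hc.fixedPoint : NonemptyCompacts (EuclideanSpace ℝ (Fin d))),
    ⟨NonemptyCompacts.nonempty _, NonemptyCompacts.isCompact _, ?_⟩, ?_⟩
  · have h : F.hutchinson hc.fixedPoint = hc.fixedPoint := hc.fixedPoint_isFixedPt
    exact (congrArg (fun A : NonemptyCompacts (EuclideanSpace ℝ (Fin d)) =>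
      (A : Set (EuclideanSpace ℝ (Fin d)))) h).symm
  · rintro K ⟨hne, hK, hEq⟩
    have h : Function.IsFixedPt F.hutchinson ⟨⟨K, hK⟩, hne⟩ :=
      NonemptyCompacts.ext hEq.symm
    exact congrArg (fun A : NonemptyCompacts (EuclideanSpace ℝ (Fin d)) =>
      (A : Set (EuclideanSpace ℝ (Fin d)))) (hc.fixedPoint_unique h)

/-- The self-similar set: the unique non-empty compact `K` with `K = ⋃ i, S_i(K)`. -/
def attractor : Set (EuclideanSpace ℝ (Fin d)) := F.existsUnique_attractor.choose

theorem attractor_spec : F.attractor.Nonempty ∧ IsCompact F.attractor ∧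
    F.attractor = ⋃ i, F.map i '' F.attractor :=
  F.existsUnique_attractor.choose_spec.1

/-- `S_w = S_{i_1} ∘ ⋯ ∘ S_{i_k}` for a finite word `w = i_1 ⋯ i_k`. -/
def wordMap : List (Fin N) → EuclideanSpace ℝ (Fin d) → EuclideanSpace ℝ (Fin d)
  | [] => id
  | i :: w => F.map i ∘ wordMap w

/-- `r_w = r_{i_1} ⋯ r_{i_k}` for a finite word `w = i_1 ⋯ i_k`. -/
def wordRatio (w : List (Fin N)) : ℝ := (w.map F.ratio).prod

/-- `r = min_i r_i`. -/
def minRatio : ℝ := ⨅ i, F.ratio i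

/-- `X_n`: the words `w = i_1 ⋯ i_k` with `r_w ≤ r ^ n < r_{i_1 ⋯ i_{k-1}}`; the second inequality
is void for the empty word, so that `X_0` consists of the empty word only. -/
def level (n : ℕ) : Set (List (Fin N)) :=
  {w | F.wordRatio w ≤ F.minRatio ^ n ∧ (w ≠ [] → F.minRatio ^ n < F.wordRatio w.dropLast)}

theorem nil_mem_level_zero : ([] : List (Fin N)) ∈ F.level 0 := by
  simp [level, wordRatio]

theorem wordRatio_pos (w : List (Fin N)) : 0 < F.wordRatio w := by
  unfold wordRatio
  exact List.prod_pos fun t ht => by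
    obtain ⟨i, -, rfl⟩ := List.mem_map.1 ht
    exact F.ratio_pos i

theorem minRatio_le (i : Fin N) : F.minRatio ≤ F.ratio i :=
  ciInf_le (Set.finite_range F.ratio).bddBelow i

theorem minRatio_pos : 0 < F.minRatio := by
  have : Nonempty (Fin N) := ⟨⟨0, F.N_pos⟩⟩
  obtain ⟨j, hj⟩ := Finite.exists_min F.ratio
  exact lt_of_lt_of_le (F.ratio_pos j) (le_ciInf hj)

theorem minRatio_lt_one : F.minRatio < 1 :=
  (F.minRatio_le ⟨0, F.N_pos⟩).trans_lt (F.ratio_lt_one _)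

/-- A word lies in at most one of the sets `X_n`. -/
theorem level_unique {m n : ℕ} {w : List (Fin N)} (hm : w ∈ F.level m) (hn : w ∈ F.level n) :
    m = n := by
  have key : ∀ {m n : ℕ}, w ∈ F.level m → w ∈ F.level n → ¬ m < n := by
    intro m n hm hn hlt
    have hpow : F.minRatio ^ n ≤ F.minRatio ^ (m + 1) :=
      pow_le_pow_of_le_one F.minRatio_pos.le F.minRatio_lt_one.le hlt
    rcases List.eq_nil_or_concat w with rfl | ⟨v, i, rfl⟩
    · have h1 : (1 : ℝ) ≤ F.minRatio ^ n := by simpa [wordRatio] using hn.1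
      exact absurd (pow_lt_one₀ F.minRatio_pos.le F.minRatio_lt_one (by omega)) h1.not_gt
    · have h1 : F.minRatio ^ m < F.wordRatio v := by simpa using hm.2 (by simp)
      have h2 : F.wordRatio v * F.ratio i ≤ F.minRatio ^ n := by
        simpa [wordRatio] using hn.1
      have h3 : F.wordRatio v * F.minRatio ≤ F.wordRatio v * F.ratio i :=
        mul_le_mul_of_nonneg_left (F.minRatio_le i) (F.wordRatio_pos v).le
      have h4 : F.minRatio ^ m * F.minRatio < F.wordRatio v * F.minRatio :=
        mul_lt_mul_of_pos_right h1 F.minRatio_pos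
      rw [pow_succ] at hpow
      linarith
  exact le_antisymm (not_lt.1 (key hn hm)) (not_lt.1 (key hm hn))

/-- The vertex set `X`, the (disjoint) union of the levels `X_n`. -/
structure Vertex where
  /-- the level of the vertex -/
  lvl : ℕ
  /-- the word -/
  word : List (Fin N)
  mem : word ∈ F.level lvl

/-- The root `ϑ`, i.e. the empty word. -/
def root : F.Vertex := ⟨0, [], F.nil_mem_level_zero⟩

/-- The cell `K_x = S_x(K)`. -/
def cell (x : F.Vertex) : Set (EuclideanSpace ℝ (Fin d)) := F.wordMap x.word '' F.attractor

/-- `dist(A, B) = inf {|p - q| : p ∈ A, q ∈ B}`. -/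
def setDist (A B : Set (EuclideanSpace ℝ (Fin d))) : ℝ := sInf (Set.image2 dist A B)

/-- The vertical edges `ℰ_v`: `x ∈ X_n` is joined to `y ∈ X_{n+1}` when `y = x z` for a word `z`. -/
def verticalGraph : SimpleGraph F.Vertex :=
  SimpleGraph.fromRel fun x y => y.lvl = x.lvl + 1 ∧ x.word <+: y.word

/-- The horizontal edges `ℰ_h`: `x ≠ y`, `|x| = |y|` and `dist(S_x(K), S_y(K)) ≤ κ r^{|x|}`. -/
def horizontalGraph (κ : ℝ) : SimpleGraph F.Vertex :=
  SimpleGraph.fromRel fun x y =>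
    x.lvl = y.lvl ∧ setDist (F.cell x) (F.cell y) ≤ κ * F.minRatio ^ x.lvl

/-- The augmented tree `(X, ℰ)`, `ℰ = ℰ_v ∪ ℰ_h`. -/
def augmentedTree (κ : ℝ) : SimpleGraph F.Vertex := F.verticalGraph ⊔ F.horizontalGraph κ

/-- `x` and `y` are identified when `|x| = |y|` and `S_x = S_y`. -/
def vertexSetoid : Setoid F.Vertex where
  r x y := x.lvl = y.lvl ∧ F.wordMap x.word = F.wordMap y.word
  iseqv := ⟨fun _ => ⟨rfl, rfl⟩, fun h => ⟨h.1.symm, h.2.symm⟩,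
    fun h k => ⟨h.1.trans k.1, h.2.trans k.2⟩⟩

/-- The vertex set `X^∼` of the quotient space. -/
def QuotVertex : Type := Quotient F.vertexSetoid

/-- The class of a vertex. -/
def toQuot (x : F.Vertex) : F.QuotVertex := Quotient.mk F.vertexSetoid x

/-- The horizontal graph of the quotient: two distinct classes are joined when some of their
representatives are. -/
def quotHorizontalGraph (κ : ℝ) : SimpleGraph F.QuotVertex :=
  (F.horizontalGraph κ).map F.toQuot

/-- The quotient space `(X^∼, ℰ)` of the augmented tree, with the induced vertical and horizontal
edges. -/
def quotAugmentedTree (κ : ℝ) : SimpleGraph F.QuotVertex :=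
  F.verticalGraph.map F.toQuot ⊔ F.quotHorizontalGraph κ

end SimilitudeIFS

end

/-! The Gromov product records the Euclidean distance between cells. If two cells of levels at least
`n` have points within `κ r^n`, their ancestors of level `n` coincide or are horizontally adjacent,
so the product is at least `n - 1/2` (`le_prod_of_dist_le`). Conversely, points of the cells of `x`
and `y` are at distance at most `C r^|x ∧ y|` (`exists_dist_le_rpow_prod`). With these two estimates
the triangle inequality in `ℝ^d` becomes hyperbolicity, and sending a vertex to a point of its cell
extends to an embedding of the boundary with image `K`. So the boundary is totally disconnected
exactly when `K` is.

It remains to compare `K` with the horizontal components. If these have at most `M` vertices, the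
points of a connected subset of `K` lie, at every level, in cells of a single component, hence
within `C (M + 1) r^n` of each other for all `n`. If `K` is totally disconnected, chains of small
steps in `K` stay short; by self-similarity and induction this holds, with uniform constants at
every scale, for unions of boundedly many cells (`exists_chainsBounded_biUnion`). Bounded degree
limits how many cells of level `m` lie near a given one. A component of level `m + k`, for fixed
large `k`, is a chain of tiny steps through those cells, so it has diameter `O(r^m)`, and bounded
degree then bounds its size.

The augmented tree and its quotient enter only through the axioms of `CellSystem`, so one proof
serves both. -/

/-! ### Chains of small steps in metric spaces -/

open Relation in
/-- Every chain of points of `A` with steps at most `ε` stays within distance `η` of its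
starting point. -/
def ChainsBounded {E : Type*} [PseudoMetricSpace E] (A : Set E) (ε η : ℝ) : Prop :=
  ∀ p ∈ A, ∀ q, ReflTransGen (fun u v => v ∈ A ∧ dist u v ≤ ε) p q → dist p q ≤ η

namespace ChainsBounded

open Relation

variable {E : Type*} [PseudoMetricSpace E]

theorem mono {A : Set E} {ε ε' η η' : ℝ} (h : ChainsBounded A ε η) (hε : ε' ≤ ε)
    (hη : η ≤ η') : ChainsBounded A ε' η' := fun p hp q hq =>
  (h p hp q (ReflTransGen.mono (fun _ _ huv => ⟨huv.1, huv.2.trans hε⟩) _ _ hq)).trans hη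

/-- The image of a set under a similitude of ratio `ρ`. -/
theorem image {A : Set E} {ε η ρ : ℝ} (h : ChainsBounded A ε η) (hρ : 0 < ρ) {g : E → E}
    (hg : ∀ p q, dist (g p) (g q) = ρ * dist p q) : ChainsBounded (g '' A) (ρ * ε) (ρ * η) := by
  rintro _ ⟨p, hp, rfl⟩ q hq
  have key : ∃ q' , q = g q' ∧ ReflTransGen (fun u v => v ∈ A ∧ dist u v ≤ ε) p q' := by
    induction hq with
    | refl => exact ⟨p, rfl, .refl⟩
    | tail _ hbc ih =>
      obtain ⟨b', rfl, hb'⟩ := ih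
      obtain ⟨⟨c', hc', rfl⟩, hd⟩ := hbc
      rw [hg] at hd
      exact ⟨c', rfl, hb'.tail ⟨hc', le_of_mul_le_mul_left hd hρ⟩⟩
  obtain ⟨q', rfl, hq'⟩ := key
  rw [hg]
  exact mul_le_mul_of_nonneg_left (h p hp q' hq') hρ.le

/-- If the chains in `A` are much shorter than the steps allowed in `B`, then the chains in
`A ∪ B` are controlled. -/
theorem union {A B : Set E} {ε εA ηA εB ηB : ℝ} (hA : ChainsBounded A εA ηA)
    (hB : ChainsBounded B εB ηB) (hε : 0 ≤ ε) (hεA : ε ≤ εA) (hηA : 0 ≤ ηA)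
    (hεB : 2 * ε + ηA ≤ εB) (hηB : 0 ≤ ηB) :
    ChainsBounded (A ∪ B) ε (2 * (ηA + ε) + ηB) := by
  intro p hp q hq
  -- Either the chain has not left `A`, or `b₀` and `b` are its first and latest recorded points in
  -- `B`. An excursion into `A` between two points of `B` has diameter controlled by `ηA`, so
  -- skipping it costs one step of at most `2 ε + ηA ≤ εB` in `B`. Only the initial and final
  -- excursions remain, each adding at most `ηA + ε`.
  have key : (p ∈ A ∧ q ∈ A ∧ ReflTransGen (fun u v => v ∈ A ∧ dist u v ≤ εA) p q) ∨
      ∃ b₀ ∈ B, ∃ b ∈ B, dist p b₀ ≤ ηA + ε ∧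
        ReflTransGen (fun u v => v ∈ B ∧ dist u v ≤ εB) b₀ b ∧
        (q = b ∨ ∃ c ∈ A, dist b c ≤ ε ∧
          ReflTransGen (fun u v => v ∈ A ∧ dist u v ≤ εA) c q) := by
    induction hq with
    | refl =>
      rcases hp with hp | hp
      · exact .inl ⟨hp, hp, .refl⟩
      · exact .inr ⟨p, hp, p, hp, by simpa using add_nonneg hηA hε, .refl, .inl rfl⟩
    | @tail s t _ hst ih =>
      obtain ⟨ht, hd⟩ := hst
      rcases ih with ⟨hpA, hsA, hps⟩ | ⟨b₀, hb₀, b, hb, hpb, hbb, hs⟩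
      · rcases ht with ht | ht
        · exact .inl ⟨hpA, ht, hps.tail ⟨ht, hd.trans hεA⟩⟩
        · refine .inr ⟨t, ht, t, ht, ?_, .refl, .inl rfl⟩
          linarith [dist_triangle p s t, hA p hpA s hps]
      · rcases ht with ht | ht
        · refine .inr ⟨b₀, hb₀, b, hb, hpb, hbb, .inr ?_⟩
          rcases hs with rfl | ⟨c, hc, hbc, hcs⟩
          · exact ⟨t, ht, hd, .refl⟩
          · exact ⟨c, hc, hbc, hcs.tail ⟨ht, hd.trans hεA⟩⟩
        · refine .inr ⟨b₀, hb₀, t, ht, hpb, hbb.tail ⟨ht, ?_⟩, .inl rfl⟩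
          rcases hs with rfl | ⟨c, hc, hbc, hcs⟩
          · linarith
          · linarith [dist_triangle4 b c s t, hA c hc s hcs]
  rcases key with ⟨hpA, -, hpq⟩ | ⟨b₀, hb₀, b, hb, hpb, hbb, hq⟩
  · linarith [hA p hpA q hpq]
  · have h1 := hB b₀ hb₀ b hbb
    rcases hq with rfl | ⟨c, hc, hbc, hcq⟩
    · linarith [dist_triangle p b₀ q]
    · linarith [dist_triangle4 p b₀ b c, dist_triangle p c q, hA c hc q hcq]

end ChainsBounded

/-- In a compact totally disconnected set, chains with small steps stay near their origin. -/
theorem IsCompact.exists_chainsBounded {E : Type*} [MetricSpace E] {K : Set E}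
    (hK : IsCompact K) (hd : IsTotallyDisconnected K) {η : ℝ} (hη : 0 < η) :
    ∃ ε : ℝ, 0 < ε ∧ ChainsBounded K ε η := by
  have : CompactSpace K := isCompact_iff_compactSpace.1 hK
  have : TotallyDisconnectedSpace K := totallyDisconnectedSpace_subtype_iff.2 hd
  have h1 : ∀ p : K, ∃ U : Set K, IsClopen U ∧ p ∈ U ∧ U ⊆ Metric.ball p (η / 2) := fun p =>
    compact_exists_isClopen_in_isOpen Metric.isOpen_ball (Metric.mem_ball_self (half_pos hη))
  choose U hU hpU hUb using h1
  -- A clopen subset of a compact space contains a thickening of itself, so sufficiently short steps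
  -- cannot leave it. Finitely many such sets cover `K`, which gives a common `ε`.
  have h2 : ∀ p : K, ∀ᶠ ε : ℝ in nhdsWithin 0 (Set.Ioi 0),
      ∀ u ∈ U p, ∀ v, dist u v ≤ ε → v ∈ U p := by
    intro p
    obtain ⟨δ, hδ, hsub⟩ := (hU p).isClosed.isCompact.exists_thickening_subset_open
      (hU p).isOpen subset_rfl
    filter_upwards [nhdsWithin_le_nhds (Iio_mem_nhds hδ)] with ε hε u hu v huv
    exact hsub (Metric.mem_thickening_iff.2 ⟨u, hu, by rw [dist_comm]; exact huv.trans_lt hε⟩)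
  obtain ⟨t, ht⟩ := isCompact_univ.elim_finite_subcover U (fun p => (hU p).isOpen)
    fun p _ => Set.mem_iUnion.2 ⟨p, hpU p⟩
  obtain ⟨ε, hε, hε0⟩ := (((Filter.eventually_all_finset t).2 fun p _ => h2 p).and
    self_mem_nhdsWithin).exists
  refine ⟨ε, hε0, fun p hp q hq => ?_⟩
  obtain ⟨i, hi, hpi⟩ := Set.mem_iUnion₂.1 (ht (Set.mem_univ (⟨p, hp⟩ : K)))
  have key : ∃ hq : q ∈ K, (⟨q, hq⟩ : K) ∈ U i := by
    induction hq with
    | refl => exact ⟨hp, hpi⟩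
    | tail _ hbc ih =>
      obtain ⟨hb, hbi⟩ := ih
      exact ⟨hbc.1, hε i hi _ hbi _ hbc.2⟩
  obtain ⟨hqK, hqi⟩ := key
  have h3 : dist p i < η / 2 := hUb i hpi
  have h4 : dist q i < η / 2 := hUb i hqi
  linarith [dist_triangle_right p q i]

/-! ### Cell systems: Gromov product, cell distances, hyperbolicity -/

/-- A graded graph whose vertices of level `n` are cells of size comparable to `r ^ n`, similar
to a fixed compact set `K`. Vertical edges respect the inclusion of cells and horizontal edges
join the cells of a level at distance at most `κ r ^ n`. -/
structure CellSystem (V E : Type*) [MetricSpace E] where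
  /-- the level of a vertex -/
  lvl : V → ℕ
  /-- the cell of a vertex -/
  cell : V → Set E
  /-- the vertical edges -/
  vert : SimpleGraph V
  /-- the horizontal edges -/
  hor : SimpleGraph V
  /-- the root -/
  root : V
  /-- the limit set -/
  K : Set E
  /-- the range of horizontal edges -/
  κ : ℝ
  /-- the contraction ratio between levels -/
  r : ℝ
  κ_pos : 0 < κ
  r_pos : 0 < r
  r_lt_one : r < 1
  isCompact_K : IsCompact K
  nonempty_K : K.Nonempty
  lvl_root : lvl root = 0
  eq_root : ∀ x, lvl x = 0 → x = root
  vert_adj : ∀ {x y}, vert.Adj x y →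
    (lvl y = lvl x + 1 ∧ cell y ⊆ cell x) ∨ (lvl x = lvl y + 1 ∧ cell x ⊆ cell y)
  exists_parent : ∀ {y n}, lvl y = n + 1 → ∃ x, lvl x = n ∧ vert.Adj x y
  hor_adj : ∀ {x y}, hor.Adj x y ↔ x ≠ y ∧ lvl x = lvl y ∧
    ∃ p ∈ cell x, ∃ q ∈ cell y, dist p q ≤ κ * r ^ lvl x
  exists_cell : ∀ p ∈ K, ∀ n, ∃ x, lvl x = n ∧ p ∈ cell x
  cell_subset : ∀ x, cell x ⊆ K
  cell_similar : ∀ x, ∃ (g : E → E) (ρ : ℝ), r ^ (lvl x + 1) ≤ ρ ∧ ρ ≤ r ^ lvl x ∧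
    (∀ p q, dist (g p) (g q) = ρ * dist p q) ∧ cell x = g '' K

namespace CellSystem

open HypGraph

variable {V E : Type*} [MetricSpace E] (S : CellSystem V E)

/-- The graph of all vertical and horizontal edges. -/
def graph : SimpleGraph V := S.vert ⊔ S.hor

theorem graph_adj_of_vert {x y : V} (h : S.vert.Adj x y) : S.graph.Adj x y := Or.inl h

theorem graph_adj_of_hor {x y : V} (h : S.hor.Adj x y) : S.graph.Adj x y := Or.inr h

theorem cell_nonempty (x : V) : (S.cell x).Nonempty := by
  obtain ⟨g, ρ, -, -, -, h⟩ := S.cell_similar x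
  rw [h]
  exact S.nonempty_K.image g

theorem exists_dist_le : ∃ D : ℝ, 0 < D ∧ ∀ x, ∀ p ∈ S.cell x, ∀ q ∈ S.cell x,
    dist p q ≤ D * S.r ^ S.lvl x := by
  obtain ⟨D, hD⟩ := Metric.isBounded_iff.1 S.isCompact_K.isBounded
  refine ⟨max D 1, lt_max_of_lt_right one_pos, fun x p hp q hq => ?_⟩
  obtain ⟨g, ρ, -, hρ, hg, hx⟩ := S.cell_similar x
  rw [hx] at hp hq
  obtain ⟨p, hp, rfl⟩ := hp
  obtain ⟨q, hq, rfl⟩ := hq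
  rw [hg]
  calc ρ * dist p q ≤ S.r ^ S.lvl x * dist p q := by gcongr
    _ ≤ S.r ^ S.lvl x * max D 1 := by
      have := S.r_pos
      gcongr
      exact (hD hp hq).trans (le_max_left _ _)
    _ = _ := mul_comm _ _

theorem exists_ancestor {n : ℕ} (x : V) (h : n ≤ S.lvl x) : ∃ z, S.lvl z = n ∧
    S.cell x ⊆ S.cell z ∧ ∃ p : S.graph.Walk x z, p.length + n = S.lvl x := by
  induction hk : S.lvl x - n generalizing x with
  | zero => exact ⟨x, by omega, subset_rfl, .nil, by simp; omega⟩
  | succ k ih =>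
    obtain ⟨y, hy, hyx⟩ := S.exists_parent (y := x) (n := S.lvl x - 1) (by omega)
    have hcell : S.cell x ⊆ S.cell y := by
      rcases S.vert_adj hyx with h' | h'
      · exact h'.2
      · omega
    obtain ⟨z, hz, hsub, p, hp⟩ := ih y (by omega) (by omega)
    refine ⟨z, hz, hcell.trans hsub, .cons (S.graph_adj_of_vert hyx.symm) p, ?_⟩
    rw [SimpleGraph.Walk.length_cons]
    omega

theorem connected : S.graph.Connected := by
  have h : ∀ x, S.graph.Reachable x S.root := fun x => by
    obtain ⟨z, hz, -, p, -⟩ := S.exists_ancestor x (Nat.zero_le _)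
    rw [S.eq_root z hz] at p
    exact ⟨p⟩
  have : Nonempty V := ⟨S.root⟩
  exact ⟨fun x y => (h x).trans (h y).symm⟩

theorem lvl_le_add_length {x y : V} (p : S.graph.Walk x y) : S.lvl x ≤ S.lvl y + p.length := by
  induction p with
  | nil => simp
  | cons h p ih =>
    rw [SimpleGraph.Walk.length_cons]
    rcases h with h | h
    · rcases S.vert_adj h with h | h <;> omega
    · have := (S.hor_adj.1 h).2.1
      omega

theorem dist_root (x : V) : S.graph.dist S.root x = S.lvl x := by
  rw [SimpleGraph.dist_comm]
  apply le_antisymm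
  · obtain ⟨z, hz, -, p, hp⟩ := S.exists_ancestor x (Nat.zero_le _)
    obtain rfl := S.eq_root z hz
    exact (SimpleGraph.dist_le p).trans hp.le
  · obtain ⟨p, hp⟩ := S.connected.exists_walk_length_eq_dist x S.root
    have := S.lvl_le_add_length p
    rw [S.lvl_root] at this
    omega

/-- The Gromov product of the graph with respect to its root. -/
noncomputable def prod (x y : V) : ℝ := gromovProduct S.graph S.root x y

theorem prod_eq (x y : V) :
    S.prod x y = ((S.lvl x : ℝ) + S.lvl y - S.graph.dist x y) / 2 := by
  simp only [prod, gromovProduct, dist_root]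

theorem prod_comm (x y : V) : S.prod x y = S.prod y x := gromovProduct_comm _ _ _ _

theorem prod_le_left (x y : V) : S.prod x y ≤ S.lvl x := by
  obtain ⟨p, hp⟩ := S.connected.exists_walk_length_eq_dist y x
  have h : ((S.lvl y : ℕ) : ℝ) ≤ S.lvl x + S.graph.dist y x := by
    exact_mod_cast hp ▸ S.lvl_le_add_length p
  rw [prod_eq, SimpleGraph.dist_comm]
  linarith

theorem prod_le_right (x y : V) : S.prod x y ≤ S.lvl y := by
  rw [prod_comm]
  exact S.prod_le_left y x

theorem prod_nonneg (x y : V) : 0 ≤ S.prod x y := by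
  have h := S.connected.dist_triangle (u := x) (v := S.root) (w := y)
  rw [SimpleGraph.dist_comm (v := S.root), dist_root, dist_root] at h
  have : (S.graph.dist x y : ℝ) ≤ S.lvl x + S.lvl y := by exact_mod_cast h
  rw [prod_eq]
  linarith

/-- The ancestors of level `n` still contain `p` and `q`, so they are equal or horizontally
adjacent: climb to level `n`, cross at most one horizontal edge, descend. -/
theorem dist_add_le_of_dist_le {x y : V} {n : ℕ} (hx : n ≤ S.lvl x) (hy : n ≤ S.lvl y) {p q : E}
    (hp : p ∈ S.cell x) (hq : q ∈ S.cell y) (h : dist p q ≤ S.κ * S.r ^ n) :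
    S.graph.dist x y + 2 * n ≤ S.lvl x + S.lvl y + 1 := by
  obtain ⟨x', hx', hxx, w, hw⟩ := S.exists_ancestor x hx
  obtain ⟨y', hy', hyy, v, hv⟩ := S.exists_ancestor y hy
  have h1 : S.graph.dist x' y' ≤ 1 := by
    by_cases e : x' = y'
    · simp [e]
    · have : S.graph.Adj x' y' := S.graph_adj_of_hor (S.hor_adj.2
        ⟨e, hx'.trans hy'.symm, p, hxx hp, q, hyy hq, by rwa [hx']⟩)
      exact (SimpleGraph.dist_eq_one_iff_adj.2 this).le
  have h2 := S.connected.dist_triangle (u := x) (v := x') (w := y)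
  have h3 := S.connected.dist_triangle (u := x') (v := y') (w := y)
  have h4 := SimpleGraph.dist_le w
  have h5 := SimpleGraph.dist_le v
  rw [SimpleGraph.dist_comm] at h5
  omega

theorem le_prod_of_dist_le {x y : V} {n : ℕ} (hx : n ≤ S.lvl x) (hy : n ≤ S.lvl y) {p q : E}
    (hp : p ∈ S.cell x) (hq : q ∈ S.cell y) (h : dist p q ≤ S.κ * S.r ^ n) :
    (n : ℝ) - 1 / 2 ≤ S.prod x y := by
  have h1 := S.dist_add_le_of_dist_le hx hy hp hq h
  have h2 : (S.graph.dist x y : ℝ) + 2 * n ≤ S.lvl x + S.lvl y + 1 := by exact_mod_cast h1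
  rw [prod_eq]
  linarith

/-- The distance of two cells is controlled by any walk between them: `ℓ` is essentially the
lowest level on the walk, and `H` counts its horizontal and superfluous vertical steps. -/
theorem exists_walk_bound : ∃ C : ℝ, 0 < C ∧ ∀ {x y : V} (w : S.graph.Walk x y), ∃ ℓ H : ℕ,
    ℓ ≤ S.lvl x ∧ ℓ ≤ S.lvl y ∧ S.lvl x + S.lvl y + H ≤ w.length + 2 * ℓ ∧
    ∀ p ∈ S.cell x, ∀ q ∈ S.cell y, dist p q ≤ C * (H + 1) * S.r ^ ℓ := by
  obtain ⟨D, hD, hcell⟩ := S.exists_dist_le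
  have hr := S.r_pos
  have hr1 := S.r_lt_one
  have hκ := S.κ_pos
  have h1r : 0 < 1 - S.r := by linarith
  -- `D + κ ≤ C` pays for a horizontal step, namely one cell diameter and one gap. `D + r C ≤ C`
  -- pays for lowering `ℓ` by one without increasing `H`; the successive diameters then sum
  -- geometrically.
  obtain ⟨C, hCdef⟩ : ∃ C, C = S.κ + D / (1 - S.r) := ⟨_, rfl⟩
  have hC1 : D + S.κ ≤ C := by
    have : D ≤ D / (1 - S.r) := (le_div_iff₀ h1r).2 (by nlinarith)
    linarith
  have hC2 : D + S.r * C ≤ C := by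
    have : D / (1 - S.r) * (1 - S.r) = D := div_mul_cancel₀ _ h1r.ne'
    nlinarith
  have hC : 0 < C := by linarith
  have hpow : ∀ {m n : ℕ}, m ≤ n → S.r ^ n ≤ S.r ^ m := fun h =>
    pow_le_pow_of_le_one hr.le hr1.le h
  refine ⟨C, hC, fun {x y} w => ?_⟩
  induction w with
  | @nil x =>
    refine ⟨S.lvl x, 0, le_rfl, le_rfl, by simp; omega, fun p hp q hq => ?_⟩
    refine (hcell x p hp q hq).trans ?_
    have := pow_pos hr (S.lvl x)
    push_cast
    nlinarith
  | @cons x z y h w ih =>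
    obtain ⟨ℓ, H, hz, hy, hlen, hd⟩ := ih
    rw [SimpleGraph.Walk.length_cons]
    have hℓ := pow_pos hr ℓ
    rcases h with h | h
    · rcases S.vert_adj h with ⟨hl, hsub⟩ | ⟨hl, hsub⟩
      · obtain ⟨u, hu⟩ := S.cell_nonempty z
        by_cases hlx : ℓ ≤ S.lvl x
        · refine ⟨ℓ, H + 1, hlx, hy, by omega, fun p hp q hq => ?_⟩
          have h1 := hcell x p hp u (hsub hu)
          have h2 := hd u hu q hq
          have h3 := hpow hlx
          push_cast
          nlinarith [dist_triangle p u q]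
        · obtain rfl : ℓ = S.lvl x + 1 := by omega
          refine ⟨S.lvl x, H, le_rfl, by omega, by omega, fun p hp q hq => ?_⟩
          have h1 := hcell x p hp u (hsub hu)
          have h2 := hd u hu q hq
          have h3 : D + C * (H + 1) * S.r ≤ C * (H + 1) := by
            have : C * H * S.r ≤ C * H := mul_le_of_le_one_right (by positivity) hr1.le
            linarith
          have h4 := mul_le_mul_of_nonneg_right h3 (pow_pos hr (S.lvl x)).le
          rw [pow_succ] at h2
          linarith [dist_triangle p u q]
      · exact ⟨ℓ, H, by omega, hy, by omega, fun p hp q hq => hd p (hsub hp) q hq⟩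
    · obtain ⟨-, hl, u, hu, v, hv, huv⟩ := S.hor_adj.1 h
      refine ⟨ℓ, H + 1, by omega, hy, by omega, fun p hp q hq => ?_⟩
      have h1 := hcell x p hp u hu
      have h2 := hd v hv q hq
      have h3 := hpow (hl ▸ hz : ℓ ≤ S.lvl x)
      push_cast
      nlinarith [dist_triangle4 p u v q]

theorem exists_add_one_mul_pow_le {s : ℝ} (h0 : 0 ≤ s) (h1 : s < 1) :
    ∃ B : ℝ, 0 < B ∧ ∀ n : ℕ, ((n : ℝ) + 1) * s ^ n ≤ B := by
  have h := tendsto_self_mul_const_pow_of_lt_one h0 h1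
  obtain ⟨B, hB⟩ := h.bddAbove_range
  refine ⟨max B 0 + 1, by positivity, fun n => ?_⟩
  have h2 : (n : ℝ) * s ^ n ≤ B := hB ⟨n, rfl⟩
  have h3 : s ^ n ≤ 1 := pow_le_one₀ h0 h1.le
  linarith [le_max_left B 0]

/-- Along a geodesic, `exists_walk_bound` gives `ℓ ≥ |x ∧ y| + H / 2`. The extra decay `r^(H/2)`
absorbs the linear factor `H + 1`. -/
theorem exists_dist_le_rpow_prod : ∃ C : ℝ, 0 < C ∧ ∀ x y, ∀ p ∈ S.cell x, ∀ q ∈ S.cell y,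
    dist p q ≤ C * S.r ^ S.prod x y := by
  obtain ⟨C, hC, h⟩ := S.exists_walk_bound
  have hr := S.r_pos
  have hs1 : S.r ^ (1 / 2 : ℝ) < 1 := Real.rpow_lt_one hr.le S.r_lt_one (by norm_num)
  obtain ⟨B, hB, hBn⟩ := exists_add_one_mul_pow_le (Real.rpow_nonneg hr.le _) hs1
  refine ⟨C * B, mul_pos hC hB, fun x y p hp q hq => ?_⟩
  obtain ⟨w, hw⟩ := S.connected.exists_walk_length_eq_dist x y
  obtain ⟨ℓ, H, -, -, hlen, hd⟩ := h w
  refine (hd p hp q hq).trans ?_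
  have h1 : (S.lvl x : ℝ) + S.lvl y + H ≤ S.graph.dist x y + 2 * ℓ := by
    exact_mod_cast hw ▸ hlen
  have h2 : S.prod x y + 1 / 2 * H ≤ ℓ := by
    rw [prod_eq]
    linarith
  have h3 : S.r ^ ℓ ≤ S.r ^ S.prod x y * (S.r ^ (1 / 2 : ℝ)) ^ H := by
    rw [← Real.rpow_natCast, ← Real.rpow_natCast, ← Real.rpow_mul hr.le, ← Real.rpow_add hr]
    exact Real.rpow_le_rpow_of_exponent_ge hr S.r_lt_one.le h2
  have h4 := Real.rpow_pos_of_pos hr (S.prod x y)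
  calc C * (H + 1) * S.r ^ ℓ ≤ C * (H + 1) * (S.r ^ S.prod x y * (S.r ^ (1 / 2 : ℝ)) ^ H) := by
        gcongr
    _ = C * (((H : ℝ) + 1) * (S.r ^ (1 / 2 : ℝ)) ^ H) * S.r ^ S.prod x y := by ring
    _ ≤ C * B * S.r ^ S.prod x y := by
        gcongr
        exact hBn H

theorem exists_mul_pow_lt (c : ℝ) {ε : ℝ} (hε : 0 < ε) : ∃ k : ℕ, c * S.r ^ k < ε := by
  have h : Filter.Tendsto (fun k : ℕ => c * S.r ^ k) Filter.atTop (nhds (c * 0)) :=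
    (tendsto_pow_atTop_nhds_zero_of_lt_one S.r_pos.le S.r_lt_one).const_mul c
  rw [mul_zero] at h
  exact (h.eventually (Iio_mem_nhds hε)).exists

theorem isHyperbolic : IsHyperbolic S.graph S.root := by
  obtain ⟨C, hC, hd⟩ := S.exists_dist_le_rpow_prod
  obtain ⟨c, hc⟩ := S.exists_mul_pow_lt (2 * C) S.κ_pos
  have hr := S.r_pos
  -- With `t` the minimum of the two products, points of the cells of `x` and `y` are within `2 C
  -- r^t`, which is at most `κ r^n` for `n = ⌊t - c⌋`. Rounding loses less than 1 and
  -- `le_prod_of_dist_le` loses 1/2, whence `c + 2`.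
  refine ⟨S.connected, c + 2, by positivity, fun x y z => ?_⟩
  change min (S.prod x z) (S.prod z y) - (c + 2) ≤ S.prod x y
  obtain ⟨t, ht⟩ : ∃ t, t = min (S.prod x z) (S.prod z y) := ⟨_, rfl⟩
  rw [← ht]
  have h1 : t ≤ S.prod x z := ht ▸ min_le_left _ _
  have h2 : t ≤ S.prod z y := ht ▸ min_le_right _ _
  by_cases htc : t < c
  · linarith [S.prod_nonneg x y]
  push Not at htc
  obtain ⟨p, hp⟩ := S.cell_nonempty x
  obtain ⟨q, hq⟩ := S.cell_nonempty y
  obtain ⟨u, hu⟩ := S.cell_nonempty z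
  have h3 := hd x z p hp u hu
  have h4 := hd z y u hu q hq
  have h5 := Real.rpow_le_rpow_of_exponent_ge hr S.r_lt_one.le h1
  have h6 := Real.rpow_le_rpow_of_exponent_ge hr S.r_lt_one.le h2
  have hfl : ((⌊t - c⌋₊ : ℕ) : ℝ) ≤ t - c := Nat.floor_le (by linarith)
  have hfl' : t - c < (⌊t - c⌋₊ : ℕ) + 1 := Nat.lt_floor_add_one _
  obtain ⟨n, hn⟩ : ∃ n, n = ⌊t - c⌋₊ := ⟨_, rfl⟩
  rw [← hn] at hfl hfl'
  have hc0 : (0 : ℝ) ≤ c := c.cast_nonneg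
  have hx : n ≤ S.lvl x := by
    have : (n : ℝ) ≤ S.lvl x := by linarith [S.prod_le_left x z]
    exact_mod_cast this
  have hy : n ≤ S.lvl y := by
    have : (n : ℝ) ≤ S.lvl y := by linarith [S.prod_le_right z y]
    exact_mod_cast this
  have h7 : S.r ^ t ≤ S.r ^ c * S.r ^ n := by
    rw [← Real.rpow_natCast, ← Real.rpow_natCast, ← Real.rpow_add hr]
    exact Real.rpow_le_rpow_of_exponent_ge hr S.r_lt_one.le (by linarith)
  have h8 : dist p q ≤ S.κ * S.r ^ n := by
    have h9 : 2 * C * S.r ^ t ≤ 2 * C * (S.r ^ c * S.r ^ n) := by gcongr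
    have h10 : 2 * C * S.r ^ c * S.r ^ n ≤ S.κ * S.r ^ n := by gcongr
    have h11 : C * S.r ^ S.prod x z ≤ C * S.r ^ t := by gcongr
    have h12 : C * S.r ^ S.prod z y ≤ C * S.r ^ t := by gcongr
    linarith [dist_triangle p u q]
  have := S.le_prod_of_dist_le hx hy hp hq h8
  linarith

end CellSystem

/-! ### The hyperbolic boundary is homeomorphic to the limit set -/

namespace HypGraph

open Filter Topology Uniformity

variable {V : Type*} {G : SimpleGraph V} {o : V} {a : ℝ}

theorem hasBasis_uniformity_visualSpace (ha : 0 < a) (h : IsHyperbolic G o) :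
    (𝓤 (VisualSpace G o a ha h)).HasBasis (fun ε : ℝ => 0 < ε)
      fun ε => {p | rho G o a p.1 p.2 < ε} := by
  refine ⟨fun t => ?_⟩
  refine (FilterBasis.mem_filter_iff _).trans ⟨?_, ?_⟩
  · rintro ⟨_, ⟨ε, hε, rfl⟩, hs⟩
    exact ⟨ε, hε, hs⟩
  · rintro ⟨ε, hε, hs⟩
    exact ⟨_, ⟨ε, hε, rfl⟩, hs⟩

theorem rho_self (x : V) : rho G o a x x = 0 := by simp [rho]

theorem eq_or_lt_gromovProduct_of_rho_lt (ha : 0 < a) {x y : V} {t : ℝ}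
    (h : rho G o a x y < Real.exp (-a * t)) : x = y ∨ t < gromovProduct G o x y := by
  by_cases e : x = y
  · exact .inl e
  · right
    rw [rho, if_neg e, Real.exp_lt_exp] at h
    nlinarith

theorem rho_lt_of_lt_gromovProduct (ha : 0 < a) {x y : V} {t : ℝ}
    (h : t < gromovProduct G o x y) : rho G o a x y < Real.exp (-a * t) := by
  by_cases e : x = y
  · rw [e, rho_self]
    exact Real.exp_pos _
  · rw [rho, if_neg e, Real.exp_lt_exp]
    nlinarith

/-- The exponent `n - 1` lies strictly below the bound `n - 1/2` of `le_prod_of_dist_le`, so strict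
inequalities for `rho` follow. -/
theorem exists_exp_neg_mul_le (ha : 0 < a) {ε : ℝ} (hε : 0 < ε) :
    ∃ n : ℕ, Real.exp (-a * (n - 1)) ≤ ε := by
  obtain ⟨n, hn⟩ := exists_nat_ge (1 - Real.log ε / a)
  refine ⟨n, (Real.le_log_iff_exp_le hε).1 ?_⟩
  have : a * (1 - Real.log ε / a) ≤ a * n := by gcongr
  rw [mul_sub, mul_div_cancel₀ _ ha.ne'] at this
  linarith

end HypGraph

namespace CellSystem

open HypGraph Filter Topology Uniformity

variable {V E : Type*} [MetricSpace E] (S : CellSystem V E) {a : ℝ} (ha : 0 < a)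

/-- The vertices with the uniform structure of the visual quasi-metric. -/
abbrev Visual : Type _ := VisualSpace S.graph S.root a ha S.isHyperbolic

/-- A point of the cell of a vertex. -/
noncomputable def point (x : S.Visual ha) : E := (S.cell_nonempty x).some

theorem point_mem (x : S.Visual ha) : S.point ha x ∈ S.cell x := (S.cell_nonempty x).some_mem

theorem uniformContinuous_point : UniformContinuous (S.point ha) := by
  rw [(hasBasis_uniformity_visualSpace ha S.isHyperbolic).uniformContinuous_iff
    Metric.uniformity_basis_dist]
  intro ε hε
  obtain ⟨C, hC, hd⟩ := S.exists_dist_le_rpow_prod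
  obtain ⟨k, hk⟩ := S.exists_mul_pow_lt C hε
  refine ⟨Real.exp (-a * k), Real.exp_pos _, fun x y hxy => ?_⟩
  change dist _ _ < ε
  rcases eq_or_lt_gromovProduct_of_rho_lt ha hxy with e | h
  · obtain rfl : x = y := e
    simpa using hε
  · refine (hd x y _ (S.point_mem ha x) _ (S.point_mem ha y)).trans_lt (hk.trans_le' ?_)
    rw [← Real.rpow_natCast]
    exact mul_le_mul_of_nonneg_left
      (Real.rpow_le_rpow_of_exponent_ge S.r_pos S.r_lt_one.le h.le) hC.le

/-- The extension of `point` to the completion. -/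
noncomputable def boundaryMap [CompleteSpace E] : UniformSpace.Completion (S.Visual ha) → E :=
  UniformSpace.Completion.extension (S.point ha)

theorem uniformContinuous_boundaryMap [CompleteSpace E] :
    UniformContinuous (S.boundaryMap ha) :=
  UniformSpace.Completion.uniformContinuous_extension

theorem boundaryMap_coe [CompleteSpace E] (x : S.Visual ha) :
    S.boundaryMap ha x = S.point ha x :=
  UniformSpace.Completion.extension_coe (S.uniformContinuous_point ha) x

theorem boundaryMap_mem [CompleteSpace E] (ξ : UniformSpace.Completion (S.Visual ha)) :
    S.boundaryMap ha ξ ∈ S.K := by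
  refine UniformSpace.Completion.induction_on ξ
    (S.isCompact_K.isClosed.preimage (S.uniformContinuous_boundaryMap ha).continuous) fun x => ?_
  rw [boundaryMap_coe]
  exact S.cell_subset x (S.point_mem ha x)

/-- The product is bounded by the level, so a vertex of level at most `n` is isolated at scale `exp
(-a n)`. If it belonged to a small set of the Cauchy filter of `ξ`, that set would be a singleton
and `ξ` a vertex. -/
theorem eventually_lt_lvl {ξ : UniformSpace.Completion (S.Visual ha)}
    (hξ : ξ ∈ boundary S.graph S.root a ha S.isHyperbolic) (n : ℕ) :
    ∀ᶠ x : S.Visual ha in comap (↑) (𝓝 ξ), n < S.lvl x := by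
  have hne : (comap ((↑) : S.Visual ha → UniformSpace.Completion (S.Visual ha)) (𝓝 ξ)).NeBot :=
    UniformSpace.Completion.isDenseInducing_coe.comap_nhds_neBot ξ
  have hcau : Cauchy (comap ((↑) : S.Visual ha → UniformSpace.Completion (S.Visual ha)) (𝓝 ξ)) :=
    cauchy_nhds.comap' (UniformSpace.Completion.comap_coe_eq_uniformity _).le hne
  obtain ⟨-, h⟩ := (hasBasis_uniformity_visualSpace ha S.isHyperbolic).cauchy_iff.1 hcau
  obtain ⟨t, ht, hsmall⟩ := h _ (Real.exp_pos (-a * n))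
  filter_upwards [ht] with x hx
  by_contra hlt
  have hsub : t ⊆ {x} := fun y hy => by
    rcases eq_or_lt_gromovProduct_of_rho_lt ha (hsmall x hx y hy) with e | h
    · exact e.symm
    · have h1 : (n : ℝ) < S.lvl x := h.trans_le (S.prod_le_left x y)
      exact absurd (by exact_mod_cast h1) hlt
  refine hξ ⟨x, ?_⟩
  have h1 : Tendsto (fun _ : S.Visual ha => (x : UniformSpace.Completion (S.Visual ha)))
      (comap ((↑) : S.Visual ha → UniformSpace.Completion (S.Visual ha)) (𝓝 ξ)) (𝓝 ξ) := by
    refine tendsto_comap.congr' ?_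
    filter_upwards [ht] with y hy
    rw [hsub hy]
  exact tendsto_nhds_unique tendsto_const_nhds h1

/-- Uniform continuity of the inverse: near two boundary points the vertices have high level, so
closeness of their points forces a large product. Closed entourages let this pass to the limit. -/
theorem exists_dist_boundaryMap_lt [CompleteSpace E]
    {W : Set (UniformSpace.Completion (S.Visual ha) × UniformSpace.Completion (S.Visual ha))}
    (hW : W ∈ 𝓤 (UniformSpace.Completion (S.Visual ha))) : ∃ δ : ℝ, 0 < δ ∧
    ∀ ξ ∈ boundary S.graph S.root a ha S.isHyperbolic,
    ∀ η ∈ boundary S.graph S.root a ha S.isHyperbolic,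
    dist (S.boundaryMap ha ξ) (S.boundaryMap ha η) < δ → (ξ, η) ∈ W := by
  obtain ⟨W', ⟨hW', hcl⟩, hsub⟩ := uniformity_hasBasis_closed.mem_iff.1 hW
  have h1 := UniformSpace.Completion.uniformContinuous_coe (S.Visual ha) hW'
  obtain ⟨ε, hε, hεW⟩ := (hasBasis_uniformity_visualSpace ha S.isHyperbolic).mem_iff.1 h1
  obtain ⟨n, hn⟩ := exists_exp_neg_mul_le ha hε
  refine ⟨S.κ * S.r ^ n, mul_pos S.κ_pos (pow_pos S.r_pos n), fun ξ hξ η hη hd => hsub ?_⟩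
  have hpt : ∀ ζ : UniformSpace.Completion (S.Visual ha),
      Tendsto (S.point ha) (comap (↑) (𝓝 ζ)) (𝓝 (S.boundaryMap ha ζ)) := fun ζ => by
    refine Tendsto.congr (fun x => S.boundaryMap_coe ha x)
      ((S.uniformContinuous_boundaryMap ha).continuous.continuousAt.tendsto.comp tendsto_comap)
  have hnbξ : (comap ((↑) : S.Visual ha → UniformSpace.Completion (S.Visual ha)) (𝓝 ξ)).NeBot :=
    UniformSpace.Completion.isDenseInducing_coe.comap_nhds_neBot ξ
  have hnbη : (comap ((↑) : S.Visual ha → UniformSpace.Completion (S.Visual ha)) (𝓝 η)).NeBot :=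
    UniformSpace.Completion.isDenseInducing_coe.comap_nhds_neBot η
  have hfst := tendsto_fst (f := comap ((↑) : S.Visual ha → _) (𝓝 ξ))
    (g := comap ((↑) : S.Visual ha → _) (𝓝 η))
  have hsnd := tendsto_snd (f := comap ((↑) : S.Visual ha → _) (𝓝 ξ))
    (g := comap ((↑) : S.Visual ha → _) (𝓝 η))
  have hdist := ((hpt ξ).comp hfst).dist ((hpt η).comp hsnd)
  have hlim := (tendsto_comap.comp hfst).prodMk_nhds (tendsto_comap.comp hsnd)
  refine hcl.mem_of_tendsto hlim ?_
  filter_upwards [hfst.eventually (S.eventually_lt_lvl ha hξ n),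
    hsnd.eventually (S.eventually_lt_lvl ha hη n), hdist.eventually (Iio_mem_nhds hd)]
    with z h1 h2 h3
  refine hεW ((rho_lt_of_lt_gromovProduct ha (t := n - 1) ?_).trans_le hn)
  have := S.le_prod_of_dist_le h1.le h2.le (S.point_mem ha z.1) (S.point_mem ha z.2)
    (le_of_lt h3)
  exact lt_of_lt_of_le (by linarith) this

theorem isEmbedding_boundaryMap [CompleteSpace E] :
    IsEmbedding fun ξ : boundary S.graph S.root a ha S.isHyperbolic => S.boundaryMap ha ξ := by
  refine IsUniformInducing.isUniformEmbedding (IsUniformInducing.mk' fun s => ?_) |>.isEmbedding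
  constructor
  · intro hs
    obtain ⟨W, hW, hWs⟩ := mem_comap.1 (uniformity_subtype.le hs)
    obtain ⟨δ, hδ, h⟩ := S.exists_dist_boundaryMap_lt ha hW
    exact ⟨_, Metric.dist_mem_uniformity hδ, fun ξ η hd => hWs (h ξ ξ.2 η η.2 hd)⟩
  · rintro ⟨t, ht, h⟩
    exact mem_of_superset (((S.uniformContinuous_boundaryMap ha).comp
      uniformContinuous_subtype_val) ht) fun z hz => h z.1 z.2 hz

theorem exists_boundaryMap_eq [CompleteSpace E] {p : E} (hp : p ∈ S.K) :
    ∃ ξ ∈ boundary S.graph S.root a ha S.isHyperbolic, S.boundaryMap ha ξ = p := by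
  have h := S.exists_cell p hp
  choose x hx hpx using h
  let u : ℕ → S.Visual ha := x
  have hcau : CauchySeq u := by
    refine (hasBasis_uniformity_visualSpace ha S.isHyperbolic).cauchySeq_iff.2 fun ε hε => ?_
    obtain ⟨n, hn⟩ := exists_exp_neg_mul_le ha hε
    refine ⟨n, fun i hi j hj => (rho_lt_of_lt_gromovProduct ha (t := n - 1) ?_).trans_le hn⟩
    have := S.le_prod_of_dist_le (hi.trans (hx i).ge) (hj.trans (hx j).ge) (hpx i) (hpx j)
      (by simpa using mul_nonneg S.κ_pos.le (pow_pos S.r_pos n).le)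
    exact lt_of_lt_of_le (by linarith) this
  have hcau' : CauchySeq fun n => (u n : UniformSpace.Completion (S.Visual ha)) :=
    hcau.map (UniformSpace.Completion.uniformContinuous_coe (S.Visual ha))
  obtain ⟨ξ, hξ⟩ := cauchySeq_tendsto_of_complete hcau'
  refine ⟨ξ, ?_, ?_⟩
  -- If the limit were a vertex `y`, some `u n` with `n > S.lvl y` would equal `y` or have product
  -- with `y` above the level of `y`; both are impossible.
  · rintro ⟨y, rfl⟩
    have h1 : Tendsto u atTop (𝓝 y) :=
      (UniformSpace.Completion.isUniformInducing_coe _).isInducing.tendsto_nhds_iff.2 hξ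
    have h2 : ∀ᶠ n in atTop, rho S.graph S.root a y (u n) < Real.exp (-a * S.lvl y) :=
      h1.eventually (UniformSpace.mem_nhds_iff.2 ⟨_,
        (hasBasis_uniformity_visualSpace ha S.isHyperbolic).mem_of_mem (Real.exp_pos _),
        subset_rfl⟩)
    obtain ⟨n, hn, hlt⟩ := (h2.and (eventually_gt_atTop (S.lvl y))).exists
    rcases eq_or_lt_gromovProduct_of_rho_lt ha hn with h3 | h3
    · have : S.lvl y = n := h3 ▸ hx n
      omega
    · exact absurd (h3.trans_le (S.prod_le_left y (u n))) (lt_irrefl _)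
  · have h1 : Tendsto (fun n => S.point ha (u n)) atTop (𝓝 (S.boundaryMap ha ξ)) :=
      Tendsto.congr (fun n => S.boundaryMap_coe ha (u n))
        ((S.uniformContinuous_boundaryMap ha).continuous.continuousAt.tendsto.comp hξ)
    refine tendsto_nhds_unique h1 (tendsto_iff_dist_tendsto_zero.2 ?_)
    obtain ⟨D, hD, hcell⟩ := S.exists_dist_le
    refine squeeze_zero (fun _ => dist_nonneg)
      (fun n => hcell (x n) _ (S.point_mem ha (u n)) p (hpx n)) ?_
    simp only [hx]
    simpa using (tendsto_pow_atTop_nhds_zero_of_lt_one S.r_pos.le S.r_lt_one).const_mul D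

theorem isTotallyDisconnected_boundary_iff [CompleteSpace E] :
    IsTotallyDisconnected (boundary S.graph S.root a ha S.isHyperbolic) ↔
      IsTotallyDisconnected S.K := by
  have hr : Set.range (fun ξ : boundary S.graph S.root a ha S.isHyperbolic =>
      S.boundaryMap ha ξ) = S.K := by
    ext p
    constructor
    · rintro ⟨ξ, rfl⟩
      exact S.boundaryMap_mem ha ξ
    · intro hp
      obtain ⟨ξ, hξ, rfl⟩ := S.exists_boundaryMap_eq ha hp
      exact ⟨⟨ξ, hξ⟩, rfl⟩
  rw [← hr, (S.isEmbedding_boundaryMap ha).isTotallyDisconnected_range,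
    totallyDisconnectedSpace_subtype_iff]

end CellSystem

/-! ### Sizes of horizontal components and total disconnectedness -/

namespace HypGraph

/-- In a connected graph of bounded degree, the balls of a given radius have bounded size. -/
theorem BoundedDegree.exists_finset {V : Type*} {G : SimpleGraph V} (hG : G.Connected)
    (h : BoundedDegree G) (n : ℕ) : ∃ B : ℕ, ∀ x, ∃ t : Finset V, t.card ≤ B ∧
      ∀ y, G.dist x y ≤ n → y ∈ t := by
  classical
  obtain ⟨D, hD⟩ := h
  have hnb : ∀ x, ∃ s : Finset V, s.card ≤ D ∧ ∀ y, G.Adj x y → y ∈ s := fun x => by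
    obtain ⟨hfin, hcard⟩ := Set.encard_le_coe_iff_finite_ncard_le.1 (hD x)
    refine ⟨hfin.toFinset, by rwa [← Set.ncard_eq_toFinset_card _ hfin], fun y hy => ?_⟩
    simpa using hy
  choose s hs hmem using hnb
  induction n with
  | zero =>
    refine ⟨1, fun x => ⟨{x}, by simp, fun y hy => ?_⟩⟩
    rw [Nat.le_zero, hG.dist_eq_zero_iff] at hy
    simp [hy]
  | succ n ih =>
    obtain ⟨B, hB⟩ := ih
    choose t ht htm using hB
    refine ⟨D * B + 1, fun x => ⟨insert x ((s x).biUnion t), ?_, fun y hy => ?_⟩⟩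
    · refine (Finset.card_insert_le _ _).trans (Nat.succ_le_succ ?_)
      exact (Finset.card_biUnion_le_card_mul _ _ B fun z _ => ht z).trans
        (Nat.mul_le_mul_right B (hs x))
    · obtain ⟨w, hw⟩ := hG.exists_walk_length_eq_dist x y
      cases w with
      | nil => exact Finset.mem_insert_self _ _
      | @cons _ z _ hxz w =>
        rw [SimpleGraph.Walk.length_cons] at hw
        have := SimpleGraph.dist_le w
        exact Finset.mem_insert_of_mem (Finset.mem_biUnion.2
          ⟨z, hmem x z hxz, htm z y (by omega)⟩)

end HypGraph

namespace CellSystem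

open HypGraph Filter Topology Relation

variable {V E : Type*} [MetricSpace E] (S : CellSystem V E)

theorem subset_cell_root : S.K ⊆ S.cell S.root := fun p hp => by
  obtain ⟨x, hx, hpx⟩ := S.exists_cell p hp 0
  rwa [S.eq_root x hx] at hpx

/-- Points of cells joined by a short horizontal walk are close. -/
theorem exists_horizontal_walk_bound : ∃ C : ℝ, 0 < C ∧ ∀ {x y : V} (w : S.hor.Walk x y),
    ∀ p ∈ S.cell x, ∀ q ∈ S.cell y, dist p q ≤ C * (w.length + 1) * S.r ^ S.lvl x := by
  obtain ⟨D, hD, hcell⟩ := S.exists_dist_le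
  have hκ := S.κ_pos
  refine ⟨D + S.κ, by positivity, fun {x y} w => ?_⟩
  induction w with
  | @nil x =>
    intro p hp q hq
    refine (hcell x p hp q hq).trans ?_
    have := pow_pos S.r_pos (S.lvl x)
    simp only [SimpleGraph.Walk.length_nil]
    push_cast
    nlinarith
  | @cons x z y h w ih =>
    intro p hp q hq
    obtain ⟨-, hl, u, hu, v, hv, huv⟩ := S.hor_adj.1 h
    have h1 := hcell x p hp u hu
    have h2 := ih v hv q hq
    rw [← hl] at h2
    rw [SimpleGraph.Walk.length_cons]
    push_cast
    linarith [dist_triangle4 p u v q]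

theorem isTotallyDisconnected_of_boundedComponents (h : BoundedComponents S.hor) :
    IsTotallyDisconnected S.K := by
  classical
  obtain ⟨M, hM⟩ := h
  obtain ⟨C, hC, hwalk⟩ := S.exists_horizontal_walk_bound
  intro A hA hconn p hp q hq
  have : PreconnectedSpace A := Subtype.preconnectedSpace hconn
  have hle : ∀ n, dist p q ≤ C * (M + 1) * S.r ^ n := fun n => by
    choose x hx hmem using fun p : A => S.exists_cell p (hA p.2) n
    -- Points within `κ r^n` have chosen cells that are equal or horizontally adjacent, so on the
    -- connected set `A` the component is constant.
    have hloc : IsLocallyConstant fun p : A => S.hor.connectedComponentMk (x p) := by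
      rw [IsLocallyConstant.iff_eventually_eq]
      intro u
      filter_upwards [Metric.ball_mem_nhds u (mul_pos S.κ_pos (pow_pos S.r_pos n))] with v hv
      rw [SimpleGraph.ConnectedComponent.eq]
      by_cases e : x v = x u
      · rw [e]
      · exact (S.hor_adj.2 ⟨e, (hx v).trans (hx u).symm, v, hmem v, u, hmem u, by
          rw [hx v]; exact (Metric.mem_ball.1 hv).le⟩).reachable
    have heq := hloc.apply_eq_of_preconnectedSpace ⟨p, hp⟩ ⟨q, hq⟩
    rw [SimpleGraph.ConnectedComponent.eq] at heq
    obtain ⟨w, hw⟩ := heq.exists_isPath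
    have hd := hwalk w p (hmem ⟨p, hp⟩) q (hmem ⟨q, hq⟩)
    rw [hx] at hd
    have hlen : w.length ≤ M := by
      have h1 : (w.support.toFinset : Set V) ⊆
          (S.hor.connectedComponentMk (x ⟨p, hp⟩)).supp := fun y hy => by
        rw [SimpleGraph.ConnectedComponent.mem_supp_iff, SimpleGraph.ConnectedComponent.eq]
        have hy' : y ∈ w.support := by simpa using hy
        exact ((w.takeUntil y hy').reachable).symm
      have h2 := (Set.encard_le_encard h1).trans (hM _)
      rw [Set.encard_coe_eq_coe_finsetCard, List.toFinset_card_of_nodup hw.support_nodup,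
        SimpleGraph.Walk.length_support] at h2
      have h3 : w.length + 1 ≤ M := by exact_mod_cast h2
      omega
    refine hd.trans ?_
    have := S.r_pos
    gcongr
  have hlim : Tendsto (fun n : ℕ => C * (M + 1) * S.r ^ n) atTop (𝓝 0) := by
    simpa using (tendsto_pow_atTop_nhds_zero_of_lt_one S.r_pos.le S.r_lt_one).const_mul
      (C * (M + 1))
  exact dist_le_zero.1 (ge_of_tendsto' hlim hle)

theorem exists_finset_of_dist_le (hG : BoundedDegree S.graph) (c : ℝ) :
    ∃ B : ℕ, ∀ x, ∃ t : Finset V, t.card ≤ B ∧ ∀ y, S.lvl y = S.lvl x →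
      ∀ p ∈ S.cell x, ∀ q ∈ S.cell y, dist p q ≤ c * S.r ^ S.lvl x → y ∈ t := by
  -- Climbing `k` levels turns the range `c r^|x|` into at most `κ r^(|x| - k)`, so graph distance
  -- is at most `2 k + 1`. Below level `k` the path through the root is short enough.
  obtain ⟨k, hk⟩ := S.exists_mul_pow_lt c S.κ_pos
  obtain ⟨B, hB⟩ := hG.exists_finset S.connected (2 * k + 1)
  refine ⟨B, fun x => ?_⟩
  obtain ⟨t, ht, htm⟩ := hB x
  refine ⟨t, ht, fun y hy p hp q hq hpq => htm y ?_⟩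
  rcases le_or_gt k (S.lvl x) with hkx | hkx
  · have h1 : dist p q ≤ S.κ * S.r ^ (S.lvl x - k) := by
      refine hpq.trans ?_
      obtain ⟨j, hj⟩ := Nat.exists_eq_add_of_le hkx
      rw [hj, Nat.add_sub_cancel_left, pow_add, ← mul_assoc]
      exact mul_le_mul_of_nonneg_right hk.le (pow_pos S.r_pos j).le
    have := S.dist_add_le_of_dist_le (n := S.lvl x - k) (by omega) (by omega) hp hq h1
    omega
  · have h1 := S.connected.dist_triangle (u := x) (v := S.root) (w := y)
    rw [SimpleGraph.dist_comm (v := S.root), dist_root, dist_root] at h1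
    omega

/-- Unions of boundedly many cells of a level satisfy a uniform chain bound. -/
theorem exists_chainsBounded_biUnion (hK : IsTotallyDisconnected S.K) (L : ℕ) :
    ∀ η : ℝ, 0 < η → ∃ ε : ℝ, 0 < ε ∧ ∀ (m : ℕ) (s : Finset V), s.card ≤ L →
      (∀ y ∈ s, S.lvl y = m) →
      ChainsBounded (⋃ y ∈ s, S.cell y) (ε * S.r ^ m) (η * S.r ^ m) := by
  classical
  have hr := S.r_pos
  have hempty : ∀ ε η : ℝ, ChainsBounded (⋃ y ∈ (∅ : Finset V), S.cell y) ε η :=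
    fun ε η p hp => by simp at hp
  induction L with
  | zero =>
    intro η hη
    refine ⟨1, one_pos, fun m s hs _ => ?_⟩
    rw [Finset.card_eq_zero.1 (Nat.le_zero.1 hs)]
    exact hempty _ _
  | succ L ih =>
    intro η hη
    obtain ⟨ε₀, hε₀, hK₀⟩ := S.isCompact_K.exists_chainsBounded hK (half_pos hη)
    have hεB : 0 < S.r * ε₀ := mul_pos hr hε₀
    obtain ⟨εB, rfl⟩ : ∃ εB, εB = S.r * ε₀ := ⟨_, rfl⟩
    -- One cell `x` is split off. Chains in the others are kept shorter than half the step `r ε₀`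
    -- allowed in `x`, so that `ChainsBounded.union` applies; the factor `r` covers the lower bound
    -- `r^(m+1)` on the similarity ratio of `x`.
    obtain ⟨εA, hεA, hA⟩ := ih (min (η / 8) (S.r * ε₀ / 2)) (by positivity)
    refine ⟨min εA (min (η / 8) (S.r * ε₀ / 4)), by positivity, fun m s hs hlvl => ?_⟩
    have hrm := pow_pos hr m
    rcases s.eq_empty_or_nonempty with rfl | ⟨x, hx⟩
    · exact hempty _ _
    have hA' := hA m (s.erase x) (by rw [Finset.card_erase_of_mem hx]; omega)
      fun y hy => hlvl y (Finset.mem_of_mem_erase hy)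
    have hB : ChainsBounded (S.cell x) (S.r * ε₀ * S.r ^ m) (η / 2 * S.r ^ m) := by
      obtain ⟨g, ρ, hρ1, hρ2, hg, hcell⟩ := S.cell_similar x
      rw [hlvl x hx] at hρ1 hρ2
      rw [hcell]
      refine (hK₀.image ((pow_pos hr _).trans_le hρ1) hg).mono ?_ ?_
      · rw [pow_succ] at hρ1
        nlinarith
      · nlinarith
    have hs' : (⋃ y ∈ s, S.cell y) = (⋃ y ∈ s.erase x, S.cell y) ∪ S.cell x := by
      rw [← Finset.insert_erase hx, Finset.set_biUnion_insert, Set.union_comm,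
        Finset.insert_erase hx]
    rw [hs']
    have h1 : min (η / 8) (S.r * ε₀ / 2) ≤ η / 8 := min_le_left _ _
    have h2 : min (η / 8) (S.r * ε₀ / 2) ≤ S.r * ε₀ / 2 := min_le_right _ _
    have h3 : min εA (min (η / 8) (S.r * ε₀ / 4)) ≤ εA := min_le_left _ _
    have h4 : min εA (min (η / 8) (S.r * ε₀ / 4)) ≤ η / 8 :=
      (min_le_right _ _).trans (min_le_left _ _)
    have h5 : min εA (min (η / 8) (S.r * ε₀ / 4)) ≤ S.r * ε₀ / 4 :=
      (min_le_right _ _).trans (min_le_right _ _)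
    refine (hA'.union hB (ε := min εA (min (η / 8) (S.r * ε₀ / 4)) * S.r ^ m) (by positivity)
      (by gcongr) (by positivity) ?_ (by positivity)).mono le_rfl ?_
    · rw [← mul_assoc, ← add_mul]
      gcongr
      linarith
    · rw [← add_mul, ← mul_assoc, ← add_mul]
      gcongr
      linarith

theorem exists_dist_le_of_reachable (hK : IsTotallyDisconnected S.K)
    (hG : BoundedDegree S.graph) : ∃ c : ℝ, ∀ x y, S.hor.Reachable x y → S.lvl y = S.lvl x ∧
      ∃ p ∈ S.cell x, ∃ q ∈ S.cell y, dist p q ≤ c * S.r ^ S.lvl x := by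
  classical
  have hr := S.r_pos
  obtain ⟨D, hD, hcell⟩ := S.exists_dist_le
  obtain ⟨B, hB⟩ := S.exists_finset_of_dist_le hG 1
  obtain ⟨ε, hε, hchain⟩ := S.exists_chainsBounded_biUnion hK B (1 / 2) (by norm_num)
  obtain ⟨k, hk⟩ := S.exists_mul_pow_lt (2 * D + S.κ) (ε := min ε (1 / 2)) (by positivity)
  choose pt hpt using S.cell_nonempty
  refine ⟨(D + 1) * (S.r ^ k)⁻¹, fun x y hxy => ?_⟩
  rw [SimpleGraph.reachable_iff_reflTransGen] at hxy
  have hrk := pow_pos hr k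
  rcases lt_or_ge (S.lvl x) k with hxk | hxk
  · have hlvl : S.lvl y = S.lvl x := by
      induction hxy with
      | refl => rfl
      | tail _ h ih => rw [← ih, (S.hor_adj.1 h).2.1]
    refine ⟨hlvl, pt x, hpt x, pt y, hpt y, ?_⟩
    have h1 := hcell S.root (pt x) (S.subset_cell_root (S.cell_subset x (hpt x)))
      (pt y) (S.subset_cell_root (S.cell_subset y (hpt y)))
    rw [S.lvl_root, pow_zero, mul_one] at h1
    have h2 : 1 ≤ (S.r ^ k)⁻¹ * S.r ^ S.lvl x := by
      rw [inv_mul_eq_div, one_le_div hrk]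
      exact pow_le_pow_of_le_one hr.le S.r_lt_one.le hxk.le
    rw [mul_assoc]
    nlinarith
  · obtain ⟨m, hm⟩ := Nat.exists_eq_add_of_le hxk
    have hrm := pow_pos hr m
    obtain ⟨z, hz, hxz, -⟩ := S.exists_ancestor (n := m) x (by omega)
    obtain ⟨t, htB, ht⟩ := hB z
    obtain ⟨s, hs⟩ : ∃ s, s = t.filter fun y => S.lvl y = m := ⟨_, rfl⟩
    have hmemA : ∀ y, m ≤ S.lvl y → dist (pt x) (pt y) ≤ S.r ^ m →
        pt y ∈ ⋃ y ∈ s, S.cell y := fun y hy hd => by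
      obtain ⟨y', hy', hsub, -⟩ := S.exists_ancestor y hy
      refine Set.mem_iUnion₂.2 ⟨y', ?_, hsub (hpt y)⟩
      rw [hs, Finset.mem_filter]
      exact ⟨ht y' (hy'.trans hz.symm) _ (hxz (hpt x)) _ (hsub (hpt y)) (by rwa [hz, one_mul]),
        hy'⟩
    have hA := hchain m s ((Finset.card_le_card (hs ▸ Finset.filter_subset _ _)).trans htB)
      fun y hy => by rw [hs, Finset.mem_filter] at hy; exact hy.2
    have hx0 := hmemA x (by omega) (by simpa using hrm.le)
    -- Bootstrap: the chain so far stays within `r^m / 2` of `pt x` and the next step is at most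
    -- `r^m / 2`, so the new point is within `r^m` and still lies in the fixed union over `s`.
    have key : S.lvl y = S.lvl x ∧ ReflTransGen
        (fun u v => v ∈ (⋃ y ∈ s, S.cell y) ∧ dist u v ≤ ε * S.r ^ m) (pt x) (pt y) := by
      induction hxy with
      | refl => exact ⟨rfl, .refl⟩
      | @tail y y' _ h ih =>
        obtain ⟨hy, hch⟩ := ih
        obtain ⟨-, hl, u, hu, v, hv, huv⟩ := S.hor_adj.1 h
        have h1 := hcell y _ (hpt y) u hu
        have h2 := hcell y' v hv _ (hpt y')
        rw [← hl, hy, hm, pow_add] at h2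
        rw [hy, hm, pow_add] at h1 huv
        have h3 : dist (pt y) (pt y') ≤ min ε (1 / 2) * S.r ^ m := by
          have := mul_le_mul_of_nonneg_right hk.le hrm.le
          linarith [dist_triangle4 (pt y) u v (pt y')]
        have h4 : min ε (1 / 2) * S.r ^ m ≤ ε * S.r ^ m := by
          gcongr
          exact min_le_left _ _
        have h5 : min ε (1 / 2) * S.r ^ m ≤ 1 / 2 * S.r ^ m := by
          gcongr
          exact min_le_right _ _
        refine ⟨hl ▸ hy, hch.tail ⟨hmemA y' (by omega) ?_, h3.trans h4⟩⟩
        linarith [hA _ hx0 _ hch, dist_triangle (pt x) (pt y) (pt y')]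
    refine ⟨key.1, pt x, hpt x, pt y, hpt y, (hA _ hx0 _ key.2).trans ?_⟩
    rw [hm, pow_add, ← mul_assoc, mul_assoc (D + 1), inv_mul_cancel₀ hrk.ne', mul_one]
    gcongr
    linarith

theorem boundedComponents_of_isTotallyDisconnected (hK : IsTotallyDisconnected S.K)
    (hG : BoundedDegree S.graph) : BoundedComponents S.hor := by
  obtain ⟨c, hc⟩ := S.exists_dist_le_of_reachable hK hG
  obtain ⟨B, hB⟩ := S.exists_finset_of_dist_le hG c
  refine ⟨B, fun T => ?_⟩
  induction T using SimpleGraph.ConnectedComponent.ind with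
  | h x =>
    obtain ⟨t, ht, hmem⟩ := hB x
    have hsub : (S.hor.connectedComponentMk x).supp ⊆ t := fun y hy => by
      rw [SimpleGraph.ConnectedComponent.mem_supp_iff, SimpleGraph.ConnectedComponent.eq] at hy
      obtain ⟨hl, p, hp, q, hq, hpq⟩ := hc x y hy.symm
      exact hmem y hl p hp q hq hpq
    refine (Set.encard_le_encard hsub).trans ?_
    rw [Set.encard_coe_eq_coe_finsetCard]
    exact_mod_cast ht

theorem isTotallyDisconnected_iff_boundedComponents (hG : BoundedDegree S.graph) :
    IsTotallyDisconnected S.K ↔ BoundedComponents S.hor :=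
  ⟨fun h => S.boundedComponents_of_isTotallyDisconnected h hG,
    S.isTotallyDisconnected_of_boundedComponents⟩

/-- The graph of a cell system is hyperbolic, and if it is of bounded degree, then its boundary
and the limit set are totally disconnected precisely when the horizontal components have bounded
size. -/
theorem hyperbolic_and_totallyDisconnected_iff [CompleteSpace E] (a : ℝ) (ha : 0 < a) :
    ∃ h : IsHyperbolic S.graph S.root, BoundedDegree S.graph →
      (IsTotallyDisconnected (boundary S.graph S.root a ha h) ↔ BoundedComponents S.hor) ∧
      (IsTotallyDisconnected S.K ↔ BoundedComponents S.hor) :=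
  ⟨S.isHyperbolic, fun hG => ⟨(S.isTotallyDisconnected_boundary_iff ha).trans
    (S.isTotallyDisconnected_iff_boundedComponents hG),
    S.isTotallyDisconnected_iff_boundedComponents hG⟩⟩

end CellSystem

/-! ### The augmented tree and its quotient as cell systems -/

namespace SimilitudeIFS

variable {d N : ℕ} (F : SimilitudeIFS d N)

theorem wordMap_append (u v : List (Fin N)) :
    F.wordMap (u ++ v) = F.wordMap u ∘ F.wordMap v := by
  induction u with
  | nil => rfl
  | cons i u ih =>
    simp only [List.cons_append, wordMap, ih]
    rfl

theorem dist_wordMap (w : List (Fin N)) (p q : EuclideanSpace ℝ (Fin d)) :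
    dist (F.wordMap w p) (F.wordMap w q) = F.wordRatio w * dist p q := by
  induction w with
  | nil => simp [wordMap, wordRatio]
  | cons i w ih =>
    simp only [wordMap, Function.comp_apply, F.dist_map, ih]
    simp [wordRatio, mul_assoc]

theorem map_image_attractor_subset (i : Fin N) : F.map i '' F.attractor ⊆ F.attractor := by
  conv_rhs => rw [F.attractor_spec.2.2]
  exact Set.subset_iUnion (fun i => F.map i '' F.attractor) i

theorem wordMap_image_attractor_subset (w : List (Fin N)) :
    F.wordMap w '' F.attractor ⊆ F.attractor := by
  induction w with
  | nil => simp [wordMap]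
  | cons i w ih =>
    rw [wordMap, Set.image_comp]
    exact (Set.image_mono ih).trans (F.map_image_attractor_subset i)

theorem cell_subset_of_prefix {x y : F.Vertex} (h : x.word <+: y.word) :
    F.cell y ⊆ F.cell x := by
  obtain ⟨v, hv⟩ := h
  rw [cell, cell, ← hv, wordMap_append, Set.image_comp]
  exact Set.image_mono (F.wordMap_image_attractor_subset v)

/-- The shortest prefix with ratio at most `r^n` qualifies. -/
theorem exists_prefix_mem_level {n : ℕ} (w : List (Fin N))
    (h : F.wordRatio w ≤ F.minRatio ^ n) : ∃ v, v <+: w ∧ v ∈ F.level n := by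
  induction w using List.reverseRecOn with
  | nil => exact ⟨[], List.prefix_rfl, h, fun h => absurd rfl h⟩
  | append_singleton w i ih =>
    by_cases hw : F.wordRatio w ≤ F.minRatio ^ n
    · obtain ⟨v, hv, hl⟩ := ih hw
      exact ⟨v, hv.trans (List.prefix_append _ _), hl⟩
    · exact ⟨_, List.prefix_rfl, h, fun _ => by simpa using hw⟩

/-- Before its last letter the word has ratio above `r^n`, and one letter costs at most a factor
`r`. -/
theorem pow_succ_le_wordRatio {n : ℕ} {w : List (Fin N)} (h : w ∈ F.level n) :
    F.minRatio ^ (n + 1) ≤ F.wordRatio w := by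
  rcases List.eq_nil_or_concat w with rfl | ⟨v, i, rfl⟩
  · simpa [wordRatio] using pow_le_one₀ F.minRatio_pos.le F.minRatio_lt_one.le
  · have h1 : F.minRatio ^ n < F.wordRatio v := by simpa using h.2 (by simp)
    have h2 : F.wordRatio (v.concat i) = F.wordRatio v * F.ratio i := by simp [wordRatio]
    rw [h2, pow_succ]
    exact mul_le_mul h1.le (F.minRatio_le i) F.minRatio_pos.le (F.wordRatio_pos v).le

theorem exists_word_of_mem_attractor {p : EuclideanSpace ℝ (Fin d)} (hp : p ∈ F.attractor)
    (k : ℕ) : ∃ w : List (Fin N), w.length = k ∧ p ∈ F.wordMap w '' F.attractor := by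
  induction k generalizing p with
  | zero => exact ⟨[], rfl, p, hp, rfl⟩
  | succ k ih =>
    rw [F.attractor_spec.2.2] at hp
    obtain ⟨i, q, hq, rfl⟩ := Set.mem_iUnion.1 hp
    obtain ⟨w, hw, q', hq', rfl⟩ := ih hq
    exact ⟨i :: w, by simp [hw], q', hq', rfl⟩

theorem exists_wordRatio_le_pow_length : ∃ ρ : ℝ, 0 ≤ ρ ∧ ρ < 1 ∧
    ∀ w, F.wordRatio w ≤ ρ ^ w.length := by
  have : Nonempty (Fin N) := ⟨⟨0, F.N_pos⟩⟩
  obtain ⟨j, hj⟩ := Finite.exists_max F.ratio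
  refine ⟨F.ratio j, (F.ratio_pos j).le, F.ratio_lt_one j, fun w => ?_⟩
  induction w with
  | nil => simp [wordRatio]
  | cons i w ih =>
    have h : F.wordRatio (i :: w) = F.ratio i * F.wordRatio w := by simp [wordRatio]
    rw [h, List.length_cons, pow_succ']
    exact mul_le_mul (hj i) ih (F.wordRatio_pos w).le (F.ratio_pos j).le

theorem exists_vertex_mem_cell {p : EuclideanSpace ℝ (Fin d)} (hp : p ∈ F.attractor) (n : ℕ) :
    ∃ x : F.Vertex, x.lvl = n ∧ p ∈ F.cell x := by
  obtain ⟨ρ, hρ0, hρ1, hρ⟩ := F.exists_wordRatio_le_pow_length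
  obtain ⟨k, hk⟩ := exists_pow_lt_of_lt_one (pow_pos F.minRatio_pos n) hρ1
  obtain ⟨w, rfl, hpw⟩ := F.exists_word_of_mem_attractor hp k
  obtain ⟨v, ⟨u, rfl⟩, hl⟩ := F.exists_prefix_mem_level w ((hρ w).trans hk.le)
  refine ⟨⟨n, v, hl⟩, rfl, ?_⟩
  rw [wordMap_append, Set.image_comp] at hpw
  exact Set.image_mono (F.wordMap_image_attractor_subset u) hpw

theorem isCompact_cell (x : F.Vertex) : IsCompact (F.cell x) := by
  refine F.attractor_spec.2.1.image ?_
  exact (LipschitzWith.of_dist_le_mul (K := ⟨_, (F.wordRatio_pos x.word).le⟩)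
    fun p q => (F.dist_wordMap x.word p q).le).continuous

theorem cell_nonempty (x : F.Vertex) : (F.cell x).Nonempty := F.attractor_spec.1.image _

theorem setDist_le_iff {A B : Set (EuclideanSpace ℝ (Fin d))} (hA : IsCompact A)
    (hB : IsCompact B) (hA' : A.Nonempty) (hB' : B.Nonempty) {c : ℝ} :
    setDist A B ≤ c ↔ ∃ p ∈ A, ∃ q ∈ B, dist p q ≤ c := by
  have hc : IsCompact (Set.image2 dist A B) := by
    rw [← Set.image_uncurry_prod]
    exact (hA.prod hB).image continuous_dist
  constructor
  · intro h
    obtain ⟨p, hp, q, hq, hpq⟩ := hc.sInf_mem (hA'.image2 hB')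
    exact ⟨p, hp, q, hq, hpq.trans_le h⟩
  · rintro ⟨p, hp, q, hq, hpq⟩
    exact (csInf_le hc.bddBelow (Set.mem_image2_of_mem hp hq)).trans hpq

theorem horizontalGraph_adj {κ : ℝ} {x y : F.Vertex} : (F.horizontalGraph κ).Adj x y ↔
    x ≠ y ∧ x.lvl = y.lvl ∧
      ∃ p ∈ F.cell x, ∃ q ∈ F.cell y, dist p q ≤ κ * F.minRatio ^ x.lvl := by
  have h := fun x y : F.Vertex => setDist_le_iff (c := κ * F.minRatio ^ x.lvl)
    (F.isCompact_cell x) (F.isCompact_cell y) (F.cell_nonempty x) (F.cell_nonempty y)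
  rw [horizontalGraph, SimpleGraph.fromRel_adj, h, h]
  constructor
  · rintro ⟨hne, h | ⟨hl, p, hp, q, hq, hpq⟩⟩
    · exact ⟨hne, h⟩
    · exact ⟨hne, hl.symm, q, hq, p, hp, by rwa [dist_comm, ← hl]⟩
  · rintro ⟨hne, h⟩
    exact ⟨hne, .inl h⟩

theorem verticalGraph_adj {x y : F.Vertex} (h : F.verticalGraph.Adj x y) :
    (y.lvl = x.lvl + 1 ∧ F.cell y ⊆ F.cell x) ∨ (x.lvl = y.lvl + 1 ∧ F.cell x ⊆ F.cell y) := by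
  rw [verticalGraph, SimpleGraph.fromRel_adj] at h
  exact h.2.imp (fun h => ⟨h.1, F.cell_subset_of_prefix h.2⟩)
    fun h => ⟨h.1, F.cell_subset_of_prefix h.2⟩

theorem exists_verticalGraph_adj {y : F.Vertex} {n : ℕ} (h : y.lvl = n + 1) :
    ∃ x : F.Vertex, x.lvl = n ∧ F.verticalGraph.Adj x y := by
  have h1 : F.wordRatio y.word ≤ F.minRatio ^ n := by
    refine y.mem.1.trans ?_
    rw [h]
    exact pow_le_pow_of_le_one F.minRatio_pos.le F.minRatio_lt_one.le n.le_succ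
  obtain ⟨v, hv, hl⟩ := F.exists_prefix_mem_level _ h1
  refine ⟨⟨n, v, hl⟩, rfl, ?_⟩
  rw [verticalGraph, SimpleGraph.fromRel_adj]
  refine ⟨?_, .inl ⟨h, hv⟩⟩
  rintro rfl
  simp at h

theorem eq_root_of_lvl_eq_zero (x : F.Vertex) (h : x.lvl = 0) : x = F.root := by
  obtain ⟨n, w, hw⟩ := x
  obtain rfl : n = 0 := h
  have h1 : w = [] := by
    by_contra hne
    have h2 := hw.2 hne
    obtain ⟨ρ, hρ0, hρ1, hρ⟩ := F.exists_wordRatio_le_pow_length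
    have h3 := (hρ w.dropLast).trans (pow_le_one₀ hρ0 hρ1.le)
    rw [pow_zero] at h2
    linarith
  subst h1
  rfl

theorem cell_eq_similar_image (x : F.Vertex) :
    ∃ (g : EuclideanSpace ℝ (Fin d) → EuclideanSpace ℝ (Fin d)) (ρ : ℝ),
      F.minRatio ^ (x.lvl + 1) ≤ ρ ∧ ρ ≤ F.minRatio ^ x.lvl ∧
      (∀ p q, dist (g p) (g q) = ρ * dist p q) ∧ F.cell x = g '' F.attractor :=
  ⟨F.wordMap x.word, F.wordRatio x.word, F.pow_succ_le_wordRatio x.mem, x.mem.1,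
    F.dist_wordMap _, rfl⟩

/-- The augmented tree as a cell system. -/
noncomputable def cellSystem {κ : ℝ} (hκ : 0 < κ) :
    CellSystem F.Vertex (EuclideanSpace ℝ (Fin d)) where
  lvl := Vertex.lvl
  cell := F.cell
  vert := F.verticalGraph
  hor := F.horizontalGraph κ
  root := F.root
  K := F.attractor
  κ := κ
  r := F.minRatio
  κ_pos := hκ
  r_pos := F.minRatio_pos
  r_lt_one := F.minRatio_lt_one
  isCompact_K := F.attractor_spec.2.1
  nonempty_K := F.attractor_spec.1
  lvl_root := rfl
  eq_root := F.eq_root_of_lvl_eq_zero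
  vert_adj := F.verticalGraph_adj
  exists_parent := F.exists_verticalGraph_adj
  hor_adj := F.horizontalGraph_adj
  exists_cell _ hp n := F.exists_vertex_mem_cell hp n
  cell_subset x := F.wordMap_image_attractor_subset x.word
  cell_similar := F.cell_eq_similar_image

/-- The level of a class of vertices. -/
def quotLvl : F.QuotVertex → ℕ := Quotient.lift Vertex.lvl fun _ _ h => h.1

/-- The cell of a class of vertices. -/
def quotCell : F.QuotVertex → Set (EuclideanSpace ℝ (Fin d)) :=
  Quotient.lift F.cell fun x y h => by rw [cell, cell, show F.wordMap x.word = _ from h.2]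

theorem toQuot_surjective : Function.Surjective F.toQuot := Quotient.mk_surjective

/-- The quotient of the augmented tree as a cell system. -/
noncomputable def quotCellSystem {κ : ℝ} (hκ : 0 < κ) :
    CellSystem F.QuotVertex (EuclideanSpace ℝ (Fin d)) where
  lvl := F.quotLvl
  cell := F.quotCell
  vert := F.verticalGraph.map F.toQuot
  hor := F.quotHorizontalGraph κ
  root := F.toQuot F.root
  K := F.attractor
  κ := κ
  r := F.minRatio
  κ_pos := hκ
  r_pos := F.minRatio_pos
  r_lt_one := F.minRatio_lt_one
  isCompact_K := F.attractor_spec.2.1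
  nonempty_K := F.attractor_spec.1
  lvl_root := rfl
  eq_root x h := by
    obtain ⟨x, rfl⟩ := F.toQuot_surjective x
    rw [F.eq_root_of_lvl_eq_zero x h]
  vert_adj h := by
    obtain ⟨-, x, y, hxy, rfl, rfl⟩ := (SimpleGraph.map_adj' _ _ _ _).1 h
    exact F.verticalGraph_adj hxy
  exists_parent {y n} h := by
    obtain ⟨y, rfl⟩ := F.toQuot_surjective y
    obtain ⟨x, hx, hxy⟩ := F.exists_verticalGraph_adj (y := y) h
    refine ⟨F.toQuot x, hx, (SimpleGraph.map_adj' _ _ _ _).2 ⟨fun e => ?_, x, y, hxy, rfl, rfl⟩⟩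
    have h1 : x.lvl = y.lvl := congrArg F.quotLvl e
    have h2 : y.lvl = n + 1 := h
    omega
  hor_adj {x y} := by
    rw [quotHorizontalGraph, SimpleGraph.map_adj']
    constructor
    · rintro ⟨hne, x, y, h, rfl, rfl⟩
      exact ⟨hne, (F.horizontalGraph_adj.1 h).2⟩
    · rintro ⟨hne, h⟩
      obtain ⟨x, rfl⟩ := F.toQuot_surjective x
      obtain ⟨y, rfl⟩ := F.toQuot_surjective y
      -- Level and cell depend only on the class, so any representatives witness the edge.
      exact ⟨hne, x, y, F.horizontalGraph_adj.2 ⟨fun e => hne (e ▸ rfl), h⟩, rfl, rfl⟩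
  exists_cell p hp n := by
    obtain ⟨x, hx, hpx⟩ := F.exists_vertex_mem_cell hp n
    exact ⟨F.toQuot x, hx, hpx⟩
  cell_subset x := by
    obtain ⟨x, rfl⟩ := F.toQuot_surjective x
    exact F.wordMap_image_attractor_subset x.word
  cell_similar x := by
    obtain ⟨x, rfl⟩ := F.toQuot_surjective x
    exact F.cell_eq_similar_image x

end SimilitudeIFS

theorem theorem1p4 {d N : ℕ} (F : SimilitudeIFS d N) (κ : ℝ) (hκ : 0 < κ) (a : ℝ) (ha : 0 < a) :
    (∃ h : HypGraph.IsHyperbolic (F.augmentedTree κ) F.root,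
      HypGraph.BoundedDegree (F.augmentedTree κ) →
        (IsTotallyDisconnected (HypGraph.boundary (F.augmentedTree κ) F.root a ha h) ↔
          HypGraph.BoundedComponents (F.horizontalGraph κ)) ∧
        (IsTotallyDisconnected F.attractor ↔
          HypGraph.BoundedComponents (F.horizontalGraph κ))) ∧
    (∃ h : HypGraph.IsHyperbolic (F.quotAugmentedTree κ) (F.toQuot F.root),
      HypGraph.BoundedDegree (F.quotAugmentedTree κ) →
        (IsTotallyDisconnected
            (HypGraph.boundary (F.quotAugmentedTree κ) (F.toQuot F.root) a ha h) ↔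
          HypGraph.BoundedComponents (F.quotHorizontalGraph κ)) ∧
        (IsTotallyDisconnected F.attractor ↔
          HypGraph.BoundedComponents (F.quotHorizontalGraph κ))) :=
  ⟨(F.cellSystem hκ).hyperbolic_and_totallyDisconnected_iff a ha,
    (F.quotCellSystem hκ).hyperbolic_and_totallyDisconnected_iff a ha⟩
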